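/- Setting. Let $\mu$ be Lebesgue measure on $[0,\infty)$ and let $N$ be a Poisson process with intensity $\mu$ on a probability space $(\Omega,\mathcal A,P)$: a random counting measure such that $N(B)$ is Poisson with parameter $\mu(B)$ for every Borel set $B$ (a.s. infinite if $\mu(B)=\infty$) and such that its values on finitely many pairwise disjoint Borel sets are independent. For $p\ge 0$ let $I_p$ be the multiple Poisson integral of order $p$, that is, the continuous linear map from the symmetric elements of $L_2(\mu^p)$ to $L_2(P)$ determined by $$I_p\Big(\sum_{\pi}1_{A_1\times\dots\times A_p}\circ\pi\Big)=p!\prod_{i=1}^p\{N(A_i)-\mu(A_i)\}$$ for pairwise disjoint Borel sets $A_1,\dots,A_p$ of finite measure, where $\pi$ runs over the permutations of the coordinates. Let $\mathcal I_p$ be the $p$-th Poisson-Wiener chaos, i.e. the closed subspace of $L_2(P)$ of all $I_p(f)$, let $T_q=\bigoplus_{p=0}^q\mathcal I_p$, and let $J_p$ be the orthogonal projection of $L_2(P)$ onto $\mathcal I_p$. For parameters $\lambda_n>0$ ($n\ge 1$) and random variables $Y_n$ put $$X_n=\frac{Y_n-\lambda_n}{\sqrt{\lambda_n}},\qquad F_n=\lambda_{2n+1}X_{2n}+\sqrt{\lambda_{2n+1}}\,X_{2n}X_{2n+1}\qquad(n\ge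 1).$$ (a) For any parameters $\lambda_n>0$ and any $N$ as above, let $Y_n=N(A_n)$ with $A_n=\big(\sum_{i=1}^{n-1}\lambda_i,\ \sum_{i=1}^{n}\lambda_i\big]$. Then $(Y_n)_{n\ge1}$ is independent and $Y_n$ is Poisson with parameter $\lambda_n$. Moreover, for all $n\ge1$, $F_n\in L_2(P)$, $F_n\in T_2$ and $J_1(F_n)=\lambda_{2n+1}X_{2n}$ a.s. (b) Let $\lambda_{2n}=n^{-3/4}$ and $\lambda_{2n+1}=n^{-5/16}$ for $n\ge1$, and let $(Y_n)_{n\ge1}$ be any independent sequence, on any probability space, such that $Y_n$ is Poisson with parameter $\lambda_n$. Then - $F_n\to0$ a.s.; - $F_n\in L_{5/2}$ for all $n\ge 1$, and $F_n\to0$ in $L_{5/2}$; - $E\{\sup_{n\ge1}|F_n|^\delta\}<\infty$ for every $\delta\in(0,1/24)$; - $\lambda_{2n+1}X_{2n}$ almost surely does not converge to $0$. (c) Consequently, the following question has a negative answer: if $F_n\to F$ a.s. and in $L_2$, with $F,F_n\in T_q$ for all $n$, does it follow that $J_p(F_n)\to J_p(F)$ a.s. for $p=0,\dots,q$? Precisely,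 there are a probability space, a Poisson process $N$ on it with intensity $\mu$, and a sequence $(F_n)$ in $T_2$ such that $F_n\to0$ a.s. and in $L_2$, but it is not true that $J_1(F_n)\to0$ a.s. -/

import Mathlib

open MeasureTheory ProbabilityTheory Filter
open scoped NNReal ENNReal Topology

noncomputable section

namespace PoissonChaos

/-- `ν` is a countable sum of measures with values in the natural numbers. -/
def IsCountingMeasure {X : Type*} [MeasurableSpace X] (ν : Measure X) : Prop :=
  ∃ ξ : ℕ → Measure X, (∀ i B, MeasurableSet B → ∃ k : ℕ, ξ i B = k) ∧ ν = Measure.sum ξ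

/-- `N` is a Poisson process (Poisson random measure) with intensity measure `μ` on the probability
space `(Ω, P)`: a random counting measure such that `N B` has the Poisson distribution with
parameter `μ B` (and is a.s. infinite if `μ B = ∞`), the values on finitely many pairwise
disjoint sets being independent. -/
structure IsPoissonProcess {Ω X : Type*} [MeasurableSpace Ω] [MeasurableSpace X]
    (N : Ω → Measure X) (μ : Measure X) (P : Measure Ω) : Prop where
  measurable : Measurable N
  counting : ∀ ω, IsCountingMeasure (N ω)
  law : ∀ B, MeasurableSet B → μ B ≠ ∞ →
    HasLaw (fun ω => N ω B) ((poissonMeasure (μ B).toNNReal).map (Nat.cast : ℕ → ℝ≥0∞)) P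
  law_top : ∀ B, MeasurableSet B → μ B = ∞ → ∀ᵐ ω ∂P, N ω B = ∞
  indep : ∀ (m : ℕ) (B : Fin m → Set X), (∀ i, MeasurableSet (B i)) →
    Pairwise (fun i j => Disjoint (B i) (B j)) → iIndepFun (fun i ω => N ω (B i)) P

section Chaos

variable {Ω X : Type*} [MeasurableSpace Ω] [MeasurableSpace X]

/-- The compensated count `N(A) - μ(A)`. -/
def compensated (N : Ω → Measure X) (μ : Measure X) (A : Set X) (ω : Ω) : ℝ :=
  (N ω A).toReal - (μ A).toReal

/-- The elementary pairs `(f, I_p(f))` in `L²(μ^p) × L²(P)`: for pairwise disjoint measurable sets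
`A_1, …, A_p` of finite measure, `f` is the sum over all permutations of the indicator of
`A_1 × ⋯ × A_p`, and `I_p(f) = p! ∏ i, (N(A_i) - μ(A_i))`. -/
def elementaryPairs (N : Ω → Measure X) (μ : Measure X) (P : Measure Ω) (p : ℕ) :
    Set (Lp ℝ 2 (Measure.pi fun _ : Fin p => μ) × Lp ℝ 2 P) :=
  {z | ∃ A : Fin p → Set X, (∀ i, MeasurableSet (A i)) ∧ (∀ i, μ (A i) ≠ ∞) ∧
    Pairwise (fun i j => Disjoint (A i) (A j)) ∧
    z.1 =ᵐ[Measure.pi fun _ : Fin p => μ] (fun x => ∑ σ : Equiv.Perm (Fin p),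
      (Set.univ.pi A).indicator (fun _ => (1 : ℝ)) (x ∘ σ)) ∧
    z.2 =ᵐ[P] fun ω => (p.factorial : ℝ) * ∏ i, compensated N μ (A i) ω}

/-- The graph of the multiple Poisson integral `I_p`, for a `σ`-finite measure `μ` without atoms and
a Poisson process `N` with intensity `μ`: the continuous linear extension of the elementary pairs.
As `μ` has no atoms, the elementary kernels span a dense subspace of the symmetric elements of
`L²(μ^p)`, so that the first components are exactly these. -/
def multipleIntegralGraph (N : Ω → Measure X) (μ : Measure X) (P : Measure Ω) (p : ℕ) :
    Submodule ℝ (Lp ℝ 2 (Measure.pi fun _ : Fin p => μ) × Lp ℝ 2 P) :=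
  (Submodule.span ℝ (elementaryPairs N μ P p)).topologicalClosure

/-- The `p`-th Poisson-Wiener chaos: all `I_p(f)` with `f` symmetric in `L²(μ^p)`. -/
def chaos (N : Ω → Measure X) (μ : Measure X) (P : Measure Ω) (p : ℕ) : Submodule ℝ (Lp ℝ 2 P) :=
  (multipleIntegralGraph N μ P p).map
    (LinearMap.snd ℝ (Lp ℝ 2 (Measure.pi fun _ : Fin p => μ)) (Lp ℝ 2 P))

/-- `T_q`, the sum of the chaoses of order `0, …, q`. -/
def chaosUpTo (N : Ω → Measure X) (μ : Measure X) (P : Measure Ω) (q : ℕ) :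
    Submodule ℝ (Lp ℝ 2 P) :=
  ⨆ p : ℕ, ⨆ _ : p ≤ q, chaos N μ P p

/-- `J_p`, the orthogonal projection of `L²(P)` onto the `p`-th chaos (a closed subspace, since
`I_p` is `√(p!)` times an isometry; taking the closure makes the projection available). -/
def chaosProj (N : Ω → Measure X) (μ : Measure X) (P : Measure Ω) (p : ℕ) :
    Lp ℝ 2 P →L[ℝ] Lp ℝ 2 P :=
  (chaos N μ P p).topologicalClosure.starProjection

end Chaos

/-- Lebesgue measure on `[0, ∞)`. -/
def halfLine : Measure ℝ≥0 := (volume : Measure ℝ).comap ((↑) : ℝ≥0 → ℝ)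

/-- The interval `A_n = (λ_1 + ⋯ + λ_{n-1}, λ_1 + ⋯ + λ_n]` of `[0, ∞)`, for `n ≥ 1`. -/
def cell (lam : ℕ → ℝ≥0) (n : ℕ) : Set ℝ≥0 :=
  Set.Ioc (∑ i ∈ Finset.Ico 1 n, lam i) (∑ i ∈ Finset.Icc 1 n, lam i)

/-- The counts `Y_n = N(A_n)`. -/
def cellCount {Ω : Type*} (N : Ω → Measure ℝ≥0) (lam : ℕ → ℝ≥0) (n : ℕ) (ω : Ω) : ℝ :=
  (N ω (cell lam n)).toReal

/-- `(Y_n)_{n ≥ 1}` is a sequence of independent random variables and `Y_n` has the Poisson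
distribution with parameter `lam n`. -/
def IsIndepPoissonSeq {Ω : Type*} [MeasurableSpace Ω] (Y : ℕ → Ω → ℝ) (lam : ℕ → ℝ≥0)
    (P : Measure Ω) : Prop :=
  iIndepFun (fun n => Y (n + 1)) P ∧
    ∀ n, 1 ≤ n → HasLaw (Y n) ((poissonMeasure (lam n)).map (Nat.cast : ℕ → ℝ)) P

/-- `X_n = (Y_n - λ_n) / √λ_n`. -/
def standardized {Ω : Type*} (Y : ℕ → Ω → ℝ) (lam : ℕ → ℝ≥0) (n : ℕ) (ω : Ω) : ℝ :=
  (Y n ω - lam n) / √(lam n)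

/-- `λ_{2n+1} X_{2n}`. -/
def firstPart {Ω : Type*} (Y : ℕ → Ω → ℝ) (lam : ℕ → ℝ≥0) (n : ℕ) (ω : Ω) : ℝ :=
  lam (2 * n + 1) * standardized Y lam (2 * n) ω

/-- `F_n = λ_{2n+1} X_{2n} + √λ_{2n+1} X_{2n} X_{2n+1}`. -/
def fullSeq {Ω : Type*} (Y : ℕ → Ω → ℝ) (lam : ℕ → ℝ≥0) (n : ℕ) (ω : Ω) : ℝ :=
  lam (2 * n + 1) * standardized Y lam (2 * n) ω +
    √(lam (2 * n + 1)) * standardized Y lam (2 * n) ω * standardized Y lam (2 * n + 1) ω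

end PoissonChaos

end

/-! Write `a = λ_{2n}` and `b = λ_{2n+1}`. Since `b + √b X_{2n+1} = Y_{2n+1}`, the two parts of
`F_n` combine to `F_n = X_{2n} Y_{2n+1}` (`fullSeq_eq`). Both parameters are small, so `Y_{2n+1}` is
usually zero and makes `F_n` vanish on events where `λ_{2n+1} X_{2n}` is large.

Bounds for `F_n`: if `Y_{2n} = 0`, then `|F_n| = √a Y_{2n+1}`; if `Y_{2n} ≥ 1`, then `|F_n| ≤
a^{-1/2} Y_{2n} Y_{2n+1}`. For `0 < p ≤ 3`, powers of counts are at most their cubes, and the third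
moment of a Poisson variable with parameter `r ≤ 1` is at most `C r`. So `E|F_n|^p` is at most `C²
a^{1-p/2} b + C a^{p/2} b`, that is, `C² n^{-17/16+3p/8} + C n^{-5/16-3p/8}`. The first term is
summable for `p < 1/6`, and the second, taken with exponent `3`, is summable; this gives almost sure
convergence and the maximal inequality. At `p = 5/2` both terms tend to zero.

Divergence: `P(Y_{2n} ≥ 1)` is at least `e^{-1} n^{-3/4}`, which is not summable, so by the second
Borel-Cantelli lemma `Y_{2n} ≥ 1` infinitely often. On that event `λ_{2n+1} X_{2n} ≥ n^{1/16} (1 -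
n^{-3/4})`.

Chaos: `F_n` is a multiple of a compensated count plus a multiple of a product of compensated counts
of disjoint sets. The former lies in the first chaos; the latter lies in the second and is
orthogonal to the first (`integral_mul_mul_eq_zero`), so `J_1` keeps only the former. For the
counterexample a Poisson process is built by superposing independent blocks, each a Poisson number
of i.i.d. points; characteristic functions identify the laws and the independence. -/

noncomputable section

namespace PoissonChaos

/-! ### Poisson moments and tail bounds -/

section Moments

/-- The inequality `n^k / k! ≤ e^n` reduces the series to the exponential series at `e r`. -/
theorem summable_pow_mul_pow_div_factorial (k : ℕ) (r : ℝ≥0) :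
    Summable fun n : ℕ => (n : ℝ) ^ k * (r : ℝ) ^ n / n.factorial := by
  have h := (Real.summable_pow_div_factorial (Real.exp 1 * r)).mul_left (k.factorial : ℝ)
  refine Summable.of_nonneg_of_le (fun n => by positivity) (fun n => ?_) h
  have h1 := Real.pow_div_factorial_le_exp (n : ℝ) (by positivity) k
  rw [div_le_iff₀ (by positivity)] at h1
  have h2 : Real.exp (n : ℝ) = Real.exp 1 ^ n := by rw [← Real.exp_nat_mul]; simp
  rw [mul_pow, ← h2, ← mul_div_assoc]
  refine div_le_div_of_nonneg_right ?_ (by positivity)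
  calc (n : ℝ) ^ k * (r : ℝ) ^ n ≤ (Real.exp n * k.factorial) * (r : ℝ) ^ n := by gcongr
    _ = _ := by ring

theorem memLp_natCast_poissonMeasure (r : ℝ≥0) (k : ℕ) :
    MemLp (Nat.cast : ℕ → ℝ) k (poissonMeasure r) := by
  have hi : Integrable (fun n : ℕ => (n : ℝ) ^ k) (poissonMeasure r) := by
    rw [integrable_poissonMeasure_iff]
    refine ((summable_pow_mul_pow_div_factorial k r).mul_left (Real.exp (-r))).congr fun n => ?_
    rw [Real.norm_of_nonneg (by positivity)]
    ring
  rcases Nat.eq_zero_or_pos k with rfl | hk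
  · simpa using (AEStronglyMeasurable.of_discrete : AEStronglyMeasurable (Nat.cast : ℕ → ℝ) _)
  · rw [← integrable_norm_rpow_iff .of_discrete (by exact_mod_cast hk.ne') (by simp)]
    simpa using hi

theorem integral_natCast_poissonMeasure (r : ℝ≥0) :
    ∫ n : ℕ, (n : ℝ) ∂poissonMeasure r = r := by
  rw [integral_poissonMeasure]
  have hs : Summable fun n : ℕ => (Real.exp (-r) * (r : ℝ) ^ n / n.factorial) • (n : ℝ) := by
    refine ((summable_pow_mul_pow_div_factorial 1 r).mul_left (Real.exp (-r))).congr fun n => ?_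
    simp only [pow_one, smul_eq_mul]
    ring
  rw [hs.tsum_eq_zero_add]
  simp only [CharP.cast_eq_zero, smul_zero, zero_add]
  have h : ∀ n : ℕ, (Real.exp (-r) * (r : ℝ) ^ (n + 1) / (n + 1).factorial) • ((n + 1 : ℕ) : ℝ)
      = r * (Real.exp (-r) * (r : ℝ) ^ n / n.factorial) := fun n => by
    rw [Nat.factorial_succ, smul_eq_mul]
    push_cast
    field_simp
    ring
  simp_rw [h]
  rw [tsum_mul_left, (hasSum_one_poissonMeasure r).tsum_eq, mul_one]

/-- The constant `∑ n, n ^ 3 / n!`. -/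
def cubeBound : ℝ≥0∞ := ∑' n : ℕ, ENNReal.ofReal ((n : ℝ) ^ 3 / n.factorial)

theorem cubeBound_ne_top : cubeBound ≠ ∞ := by
  have h : Summable fun n : ℕ => (n : ℝ) ^ 3 / n.factorial := by
    simpa using summable_pow_mul_pow_div_factorial 3 1
  exact h.tsum_ofReal_ne_top

/-- The term `n = 0` vanishes, and `r^n ≤ r` for `n ≥ 1` because `r ≤ 1`. Linearity in `r` is what
makes the later exponents work. -/
theorem lintegral_cube_poissonMeasure_le {r : ℝ≥0} (hr : r ≤ 1) :
    ∫⁻ n : ℕ, (n : ℝ≥0∞) ^ 3 ∂poissonMeasure r ≤ r * cubeBound := by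
  rw [poissonMeasure, lintegral_sum_measure, cubeBound, ← ENNReal.tsum_mul_left]
  refine ENNReal.tsum_le_tsum fun n => ?_
  rw [lintegral_smul_measure, lintegral_dirac, smul_eq_mul]
  rcases Nat.eq_zero_or_pos n with rfl | hn
  · simp
  have h1 : (n : ℝ≥0∞) ^ 3 = ENNReal.ofReal ((n : ℝ) ^ 3) := by
    rw [ENNReal.ofReal_pow (by positivity), ENNReal.ofReal_natCast]
  rw [h1, ← ENNReal.ofReal_coe_nnreal, ← ENNReal.ofReal_mul (by positivity),
    ← ENNReal.ofReal_mul (by positivity)]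
  refine ENNReal.ofReal_le_ofReal ?_
  have h2 : Real.exp (-r) ≤ 1 := Real.exp_le_one_iff.2 (by simp)
  have h3 : (r : ℝ) ^ n ≤ r := pow_le_of_le_one r.2 (by exact_mod_cast hr) hn.ne'
  calc Real.exp (-r) * (r : ℝ) ^ n / n.factorial * (n : ℝ) ^ 3
      ≤ 1 * (r : ℝ) / n.factorial * (n : ℝ) ^ 3 := by gcongr
    _ = _ := by ring

variable {Ω : Type*} [MeasurableSpace Ω] {P : Measure Ω} {Y : Ω → ℝ} {r : ℝ≥0}

theorem ae_exists_natCast_eq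
    (hY : HasLaw Y ((poissonMeasure r).map (Nat.cast : ℕ → ℝ)) P) :
    ∀ᵐ ω ∂P, ∃ k : ℕ, Y ω = k := by
  have hm : MeasurableSet (Set.range (Nat.cast : ℕ → ℝ)) := (Set.countable_range _).measurableSet
  have h : ∀ᵐ ω ∂P, Y ω ∈ Set.range (Nat.cast : ℕ → ℝ) := by
    rw [hY.ae_iff (p := fun x => x ∈ Set.range (Nat.cast : ℕ → ℝ)) hm.mem]
    refine (ae_map_iff .of_discrete hm).2 ?_
    exact .of_forall fun n => ⟨n, rfl⟩
  filter_upwards [h] with ω hω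
  obtain ⟨k, hk⟩ := hω
  exact ⟨k, hk.symm⟩

theorem memLp_of_hasLaw (hY : HasLaw Y ((poissonMeasure r).map (Nat.cast : ℕ → ℝ)) P) (k : ℕ) :
    MemLp Y k P := by
  have h : MemLp id k ((poissonMeasure r).map (Nat.cast : ℕ → ℝ)) :=
    (memLp_map_measure_iff aestronglyMeasurable_id .of_discrete).2
      (memLp_natCast_poissonMeasure r k)
  rw [← hY.map_eq] at h
  exact (memLp_map_measure_iff aestronglyMeasurable_id hY.aemeasurable).1 h

theorem integral_of_hasLaw (hY : HasLaw Y ((poissonMeasure r).map (Nat.cast : ℕ → ℝ)) P) :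
    ∫ ω, Y ω ∂P = r := by
  rw [hY.integral_eq, integral_map .of_discrete (by fun_prop), integral_natCast_poissonMeasure]

theorem lintegral_cube_le (hY : HasLaw Y ((poissonMeasure r).map (Nat.cast : ℕ → ℝ)) P)
    (hr : r ≤ 1) : ∫⁻ ω, ‖Y ω‖ₑ ^ 3 ∂P ≤ r * cubeBound := by
  rw [hY.lintegral_comp (f := fun x => ‖x‖ₑ ^ 3) (by fun_prop),
    lintegral_map (by fun_prop) .of_discrete]
  refine le_trans (le_of_eq ?_) (lintegral_cube_poissonMeasure_le hr)
  refine lintegral_congr fun n => ?_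
  simp

/-- The single atom at `1` already has mass `e^{-r} r ≥ e^{-1} r`. -/
theorem le_measure_one_le (hY : HasLaw Y ((poissonMeasure r).map (Nat.cast : ℕ → ℝ)) P)
    (hr : r ≤ 1) : ENNReal.ofReal (Real.exp (-1)) * r ≤ P {ω | 1 ≤ Y ω} := by
  have hm : MeasurableSet {x : ℝ | 1 ≤ x} := measurableSet_Ici
  rw [hY.measure_eq (p := fun x => 1 ≤ x) hm, Measure.map_apply .of_discrete hm]
  calc ENNReal.ofReal (Real.exp (-1)) * r ≤ poissonMeasure r {1} := by
        rw [poissonMeasure_singleton, ← ENNReal.ofReal_coe_nnreal,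
          ← ENNReal.ofReal_mul (by positivity)]
        refine ENNReal.ofReal_le_ofReal ?_
        have : Real.exp (-1) ≤ Real.exp (-r) := by
          refine Real.exp_le_exp.2 (neg_le_neg ?_)
          exact_mod_cast hr
        simpa using mul_le_mul_of_nonneg_right this r.2
    _ ≤ _ := measure_mono (by simp)

end Moments

/-! ### A pointwise bound for counts -/

section Pointwise

theorem natCast_rpow_le_cube {p : ℝ} (hp : 0 < p) (hp3 : p ≤ 3) (k : ℕ) :
    (k : ℝ≥0) ^ p ≤ (k : ℝ≥0) ^ 3 := by
  rcases Nat.eq_zero_or_pos k with rfl | hk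
  · simp [hp.ne']
  · have h : (1 : ℝ≥0) ≤ k := by exact_mod_cast hk
    calc (k : ℝ≥0) ^ p ≤ (k : ℝ≥0) ^ (3 : ℝ) := NNReal.rpow_le_rpow_of_exponent_le h hp3
      _ = _ := by norm_cast

/-- For `k = 0` the left side is exactly the last summand. For `k ≥ 1`, `a ≤ 1` gives `|k - a| ≤ k`,
which yields the first summand. -/
theorem nnnorm_rpow_le {a : ℝ≥0} (ha : 0 < a) (ha1 : a ≤ 1) {p : ℝ} (hp : 0 < p) (hp3 : p ≤ 3)
    (k l : ℕ) : ‖((k : ℝ) - a) / √a * l‖₊ ^ p ≤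
      a ^ (-(p / 2)) * (k : ℝ≥0) ^ 3 * (l : ℝ≥0) ^ 3 + (a ^ (1 / 2 : ℝ) * l) ^ p := by
  have hs : (√(a : ℝ)) = ((a ^ (1 / 2 : ℝ) : ℝ≥0) : ℝ) := by
    rw [Real.sqrt_eq_rpow, NNReal.coe_rpow]
  have hs0 : 0 < a ^ (1 / 2 : ℝ) := NNReal.rpow_pos ha
  have hsq : a ^ (1 / 2 : ℝ) * a ^ (1 / 2 : ℝ) = a := by
    rw [← NNReal.rpow_add ha.ne']; norm_num
  rcases Nat.eq_zero_or_pos k with rfl | hk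
  · refine le_trans (le_of_eq ?_) le_add_self
    congr 1
    ext
    rw [hs]
    simp only [CharP.cast_eq_zero, zero_sub, coe_nnnorm, norm_mul, norm_div, norm_neg,
      NNReal.norm_eq, Real.norm_natCast, NNReal.coe_mul, NNReal.coe_natCast]
    congr 1
    rw [div_eq_iff (by exact_mod_cast hs0.ne')]
    exact_mod_cast hsq.symm
  · refine le_trans ?_ le_self_add
    have hk1 : (1 : ℝ) ≤ k := by exact_mod_cast hk
    have ha1' : (a : ℝ) ≤ 1 := by exact_mod_cast ha1
    have h : ‖((k : ℝ) - a) / √a * l‖₊ ≤ a ^ (-(1 / 2) : ℝ) * (k * l) := by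
      rw [← NNReal.coe_le_coe, hs, NNReal.rpow_neg]
      simp only [coe_nnnorm, norm_mul, norm_div, NNReal.norm_eq, Real.norm_natCast,
        NNReal.coe_mul, NNReal.coe_natCast, NNReal.coe_inv]
      rw [Real.norm_of_nonneg (by linarith), div_eq_inv_mul, mul_assoc]
      gcongr
      linarith [a.2]
    calc ‖((k : ℝ) - a) / √a * l‖₊ ^ p ≤ (a ^ (-(1 / 2) : ℝ) * (k * l)) ^ p := by gcongr
      _ = a ^ (-(p / 2)) * (k : ℝ≥0) ^ p * (l : ℝ≥0) ^ p := by
        rw [NNReal.mul_rpow, NNReal.mul_rpow, ← NNReal.rpow_mul, mul_assoc]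
        congr 2
        ring
      _ ≤ _ := by gcongr <;> exact natCast_rpow_le_cube hp hp3 _

end Pointwise

/-! ### The product form of `F_n` and its consequences -/

section FullSeq

/-- Factor out `X_{2n}`: the remaining factor `λ_{2n+1} + √λ_{2n+1} X_{2n+1}` is `Y_{2n+1}`. -/
theorem fullSeq_eq {Ω : Type*} {Y : ℕ → Ω → ℝ} {lam : ℕ → ℝ≥0} {n : ℕ}
    (hb : 0 < lam (2 * n + 1)) (ω : Ω) :
    fullSeq Y lam n ω = (Y (2 * n) ω - lam (2 * n)) / √(lam (2 * n)) * Y (2 * n + 1) ω := by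
  have hs : √(lam (2 * n + 1) : ℝ) ≠ 0 := by
    rw [Real.sqrt_ne_zero']; exact_mod_cast hb
  simp only [fullSeq, standardized]
  field_simp
  ring

variable {Ω : Type*} [MeasurableSpace Ω] {P : Measure Ω} {Y : ℕ → Ω → ℝ} {lam : ℕ → ℝ≥0}

namespace IsIndepPoissonSeq

theorem ae_enorm_fullSeq_rpow_le (hY : IsIndepPoissonSeq Y lam P) {n : ℕ} (hn : 1 ≤ n)
    (ha : 0 < lam (2 * n)) (ha1 : lam (2 * n) ≤ 1) (hb : 0 < lam (2 * n + 1)) {p : ℝ}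
    (hp : 0 < p) (hp3 : p ≤ 3) : ∀ᵐ ω ∂P, ‖fullSeq Y lam n ω‖ₑ ^ p ≤
      ((lam (2 * n) ^ (-(p / 2)) : ℝ≥0) : ℝ≥0∞) * (‖Y (2 * n) ω‖ₑ ^ 3 * ‖Y (2 * n + 1) ω‖ₑ ^ 3) +
        (((lam (2 * n) ^ (1 / 2 : ℝ) : ℝ≥0) : ℝ≥0∞) * ‖Y (2 * n + 1) ω‖ₑ) ^ p := by
  filter_upwards [ae_exists_natCast_eq (hY.2 (2 * n) (by omega)),
    ae_exists_natCast_eq (hY.2 (2 * n + 1) (by omega))] with ω ⟨k, hk⟩ ⟨l, hl⟩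
  rw [fullSeq_eq hb, hk, hl]
  have h := nnnorm_rpow_le ha ha1 hp hp3 k l
  rw [mul_assoc (lam (2 * n) ^ (-(p / 2)))] at h
  have h' := ENNReal.coe_le_coe.2 h
  push_cast [ENNReal.coe_rpow_of_nonneg _ hp.le] at h'
  simpa [enorm_eq_nnnorm] using h'

theorem indepFun (hY : IsIndepPoissonSeq Y lam P) {m n : ℕ} (hm : 1 ≤ m) (hn : 1 ≤ n)
    (hmn : m ≠ n) : IndepFun (Y m) (Y n) P := by
  have h := hY.1.indepFun (i := m - 1) (j := n - 1) (by omega)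
  simpa only [Nat.sub_add_cancel hm, Nat.sub_add_cancel hn] using h

theorem aemeasurable (hY : IsIndepPoissonSeq Y lam P) {n : ℕ} (hn : 1 ≤ n) :
    AEMeasurable (Y n) P := (hY.2 n hn).aemeasurable

theorem lintegral_cube_mul_cube_le (hY : IsIndepPoissonSeq Y lam P) {m n : ℕ} (hm : 1 ≤ m)
    (hn : 1 ≤ n) (hmn : m ≠ n) (hm1 : lam m ≤ 1) (hn1 : lam n ≤ 1) :
    ∫⁻ ω, ‖Y m ω‖ₑ ^ 3 * ‖Y n ω‖ₑ ^ 3 ∂P ≤ (lam m * cubeBound) * (lam n * cubeBound) := by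
  have hi : IndepFun (fun ω => ‖Y m ω‖ₑ ^ 3) (fun ω => ‖Y n ω‖ₑ ^ 3) P :=
    (hY.indepFun hm hn hmn).comp (φ := fun x => ‖x‖ₑ ^ 3) (ψ := fun x => ‖x‖ₑ ^ 3)
      (by fun_prop) (by fun_prop)
  have hm' := hY.aemeasurable hm
  have hn' := hY.aemeasurable hn
  rw [lintegral_mul_eq_lintegral_mul_lintegral_of_indepFun'' (by fun_prop) (by fun_prop) hi]
  exact mul_le_mul' (lintegral_cube_le (hY.2 m hm) hm1) (lintegral_cube_le (hY.2 n hn) hn1)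

theorem aemeasurable_fullSeq (hY : IsIndepPoissonSeq Y lam P) {n : ℕ} (hn : 1 ≤ n) :
    AEMeasurable (fullSeq Y lam n) P := by
  have h2 := hY.aemeasurable (n := 2 * n) (by omega)
  have h3 := hY.aemeasurable (n := 2 * n + 1) (by omega)
  unfold fullSeq standardized
  fun_prop

end IsIndepPoissonSeq

end FullSeq

/-! ### Convergence and maximal bound for the special parameters -/

section SpecialParameters

variable {Ω : Type*} [MeasurableSpace Ω] {P : Measure Ω} {Y : ℕ → Ω → ℝ} {lam : ℕ → ℝ≥0}

theorem pos_and_le_one_of_eq_rpow {n : ℕ} (hn : 1 ≤ n) {c : ℝ} (hc : c ≤ 0) {a : ℝ≥0}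
    (ha : a = (n : ℝ≥0) ^ c) : 0 < a ∧ a ≤ 1 := by
  have hn' : (0 : ℝ≥0) < n := by exact_mod_cast hn
  refine ⟨ha ▸ NNReal.rpow_pos hn', ?_⟩
  rw [ha]
  calc (n : ℝ≥0) ^ c ≤ (n : ℝ≥0) ^ (0 : ℝ) :=
        NNReal.rpow_le_rpow_of_exponent_le (by exact_mod_cast hn) hc
    _ = 1 := NNReal.rpow_zero _

theorem tsum_coe_rpow_succ_ne_top {c : ℝ} (hc : c < -1) :
    ∑' n : ℕ, ((((n + 1 : ℕ) : ℝ≥0) ^ c : ℝ≥0) : ℝ≥0∞) ≠ ∞ := by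
  rw [ENNReal.tsum_coe_ne_top_iff_summable]
  exact (NNReal.summable_nat_add_iff 1).2 (NNReal.summable_rpow.2 hc)

theorem tendsto_coe_rpow_atTop_zero {c : ℝ} (hc : c < 0) :
    Tendsto (fun n : ℕ => (((n : ℝ≥0) ^ c : ℝ≥0) : ℝ≥0∞)) atTop (𝓝 0) := by
  have h : Tendsto (fun n : ℕ => ((n : ℝ) ^ c)) atTop (𝓝 0) := by
    have := (tendsto_rpow_neg_atTop (y := -c) (by linarith)).comp tendsto_natCast_atTop_atTop
    simpa [Function.comp_def] using this
  rw [← ENNReal.coe_zero, ENNReal.tendsto_coe, ← NNReal.tendsto_coe]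
  simpa using h

/-- The conditions `λ_{2n} = n^{-3/4}` and `λ_{2n+1} = n^{-5/16}` for `n ≥ 1`. -/
structure IsSpecial (lam : ℕ → ℝ≥0) : Prop where
  even : ∀ n : ℕ, 1 ≤ n → lam (2 * n) = (n : ℝ≥0) ^ (-(3 / 4) : ℝ)
  odd : ∀ n : ℕ, 1 ≤ n → lam (2 * n + 1) = (n : ℝ≥0) ^ (-(5 / 16) : ℝ)

/-- The weighted product `λ_{2n}^{-p/2} Y_{2n}³ Y_{2n+1}³`. -/
def jointTerm (Y : ℕ → Ω → ℝ) (lam : ℕ → ℝ≥0) (p : ℝ) (n : ℕ) (ω : Ω) : ℝ≥0∞ :=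
  ((lam (2 * n) ^ (-(p / 2)) : ℝ≥0) : ℝ≥0∞) * (‖Y (2 * n) ω‖ₑ ^ 3 * ‖Y (2 * n + 1) ω‖ₑ ^ 3)

/-- The weighted count `λ_{2n}^{1/2} Y_{2n+1}`. -/
def oddTerm (Y : ℕ → Ω → ℝ) (lam : ℕ → ℝ≥0) (n : ℕ) (ω : Ω) : ℝ≥0∞ :=
  ((lam (2 * n) ^ (1 / 2 : ℝ) : ℝ≥0) : ℝ≥0∞) * ‖Y (2 * n + 1) ω‖ₑ

theorem aemeasurable_jointTerm (hY : IsIndepPoissonSeq Y lam P) {n : ℕ} (hn : 1 ≤ n) (p : ℝ) :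
    AEMeasurable (jointTerm Y lam p n) P := by
  have h2 := hY.aemeasurable (n := 2 * n) (by omega)
  have h3 := hY.aemeasurable (n := 2 * n + 1) (by omega)
  unfold jointTerm
  fun_prop

theorem aemeasurable_oddTerm (hY : IsIndepPoissonSeq Y lam P) {n : ℕ} (hn : 1 ≤ n) :
    AEMeasurable (oddTerm Y lam n) P := by
  have h3 := hY.aemeasurable (n := 2 * n + 1) (by omega)
  unfold oddTerm
  fun_prop

theorem eLpNorm_fullSeq (n : ℕ) : eLpNorm (fullSeq Y lam n) (5 / 2) P =
    (∫⁻ ω, ‖fullSeq Y lam n ω‖ₑ ^ (5 / 2 : ℝ) ∂P) ^ (2 / 5 : ℝ) := by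
  have h : ((5 / 2 : ℝ≥0∞)).toReal = 5 / 2 := by simp
  rw [eLpNorm_eq_lintegral_rpow_enorm_toReal (by simp) (by simp [ENNReal.div_eq_top]), h]
  norm_num

variable (hlam : IsSpecial lam) (hY : IsIndepPoissonSeq Y lam P)
include hlam hY

theorem ae_enorm_fullSeq_rpow_le_add {n : ℕ} (hn : 1 ≤ n) {p : ℝ} (hp : 0 < p) (hp3 : p ≤ 3) :
    ∀ᵐ ω ∂P, ‖fullSeq Y lam n ω‖ₑ ^ p ≤ jointTerm Y lam p n ω + oddTerm Y lam n ω ^ p := by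
  obtain ⟨ha, ha1⟩ := pos_and_le_one_of_eq_rpow hn (by norm_num) (hlam.even n hn)
  obtain ⟨hb, -⟩ := pos_and_le_one_of_eq_rpow hn (by norm_num) (hlam.odd n hn)
  exact hY.ae_enorm_fullSeq_rpow_le hn ha ha1 hb hp hp3

/-- By independence the integral is at most `C² a^{1-p/2} b`; the exponent is `3p/8 - 3/4 - 5/16`.
-/
theorem lintegral_jointTerm_le {n : ℕ} (hn : 1 ≤ n) (p : ℝ) :
    ∫⁻ ω, jointTerm Y lam p n ω ∂P ≤
      (((n : ℝ≥0) ^ (-(17 / 16) + 3 / 8 * p) : ℝ≥0) : ℝ≥0∞) * cubeBound ^ 2 := by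
  obtain ⟨-, ha1⟩ := pos_and_le_one_of_eq_rpow hn (by norm_num) (hlam.even n hn)
  obtain ⟨-, hb1⟩ := pos_and_le_one_of_eq_rpow hn (by norm_num) (hlam.odd n hn)
  have hn0 : (n : ℝ≥0) ≠ 0 := by exact_mod_cast (by omega : n ≠ 0)
  unfold jointTerm
  rw [lintegral_const_mul' _ _ ENNReal.coe_ne_top]
  calc _ ≤ ((lam (2 * n) ^ (-(p / 2)) : ℝ≥0) : ℝ≥0∞) *
        ((lam (2 * n) * cubeBound) * (lam (2 * n + 1) * cubeBound)) :=
        mul_le_mul_right (hY.lintegral_cube_mul_cube_le (by omega) (by omega) (by omega) ha1 hb1) _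
    _ = ((lam (2 * n) ^ (-(p / 2)) * lam (2 * n) * lam (2 * n + 1) : ℝ≥0) : ℝ≥0∞) *
        cubeBound ^ 2 := by push_cast; ring
    _ = _ := by
      congr 2
      rw [hlam.even n hn, hlam.odd n hn, ← NNReal.rpow_mul, ← NNReal.rpow_add hn0,
        ← NNReal.rpow_add hn0]
      congr 1
      ring

theorem lintegral_oddTerm_rpow_le {n : ℕ} (hn : 1 ≤ n) {p : ℝ} (hp : 0 < p) (hp3 : p ≤ 3) :
    ∫⁻ ω, oddTerm Y lam n ω ^ p ∂P ≤
      (((n : ℝ≥0) ^ (-(5 / 16) - 3 / 8 * p) : ℝ≥0) : ℝ≥0∞) * cubeBound := by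
  obtain ⟨-, hb1⟩ := pos_and_le_one_of_eq_rpow hn (by norm_num) (hlam.odd n hn)
  have hn0 : (n : ℝ≥0) ≠ 0 := by exact_mod_cast (by omega : n ≠ 0)
  have hlaw := hY.2 (2 * n + 1) (by omega)
  calc ∫⁻ ω, oddTerm Y lam n ω ^ p ∂P
      ≤ ∫⁻ ω, ((lam (2 * n) ^ (p / 2) : ℝ≥0) : ℝ≥0∞) * ‖Y (2 * n + 1) ω‖ₑ ^ 3 ∂P := by
        refine lintegral_mono_ae ?_
        filter_upwards [ae_exists_natCast_eq hlaw] with ω ⟨l, hl⟩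
        rw [oddTerm, hl, ENNReal.mul_rpow_of_nonneg _ _ hp.le,
          ← ENNReal.coe_rpow_of_nonneg _ hp.le, ← NNReal.rpow_mul, one_div_mul_eq_div]
        gcongr
        have := ENNReal.coe_le_coe.2 (natCast_rpow_le_cube hp hp3 l)
        rw [ENNReal.coe_rpow_of_nonneg _ hp.le] at this
        simpa using this
    _ ≤ ((lam (2 * n) ^ (p / 2) : ℝ≥0) : ℝ≥0∞) * (lam (2 * n + 1) * cubeBound) := by
        rw [lintegral_const_mul' _ _ ENNReal.coe_ne_top]
        exact mul_le_mul_right (lintegral_cube_le hlaw hb1) _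
    _ = ((lam (2 * n) ^ (p / 2) * lam (2 * n + 1) : ℝ≥0) : ℝ≥0∞) * cubeBound := by
        push_cast; ring
    _ = _ := by
      congr 2
      rw [hlam.even n hn, hlam.odd n hn, ← NNReal.rpow_mul, ← NNReal.rpow_add hn0]
      congr 1
      ring

/-- The threshold `1/6` is where `-17/16 + 3p/8` reaches `-1`. -/
theorem lintegral_tsum_jointTerm_ne_top {p : ℝ} (hp : p < 1 / 6) :
    ∫⁻ ω, ∑' n : ℕ, jointTerm Y lam p (n + 1) ω ∂P ≠ ∞ := by
  rw [lintegral_tsum fun n => aemeasurable_jointTerm hY (by omega) p]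
  refine ne_top_of_le_ne_top ?_ (ENNReal.tsum_le_tsum fun n =>
    lintegral_jointTerm_le hlam hY (n := n + 1) (by omega) p)
  rw [ENNReal.tsum_mul_right]
  exact ENNReal.mul_ne_top (tsum_coe_rpow_succ_ne_top (by linarith))
    (ENNReal.pow_ne_top cubeBound_ne_top)

/-- With exponent `3` the terms decay like `n^{-23/16}`. A small exponent would not give a
convergent series, so this summand is handled separately from the joint one. -/
theorem lintegral_tsum_oddTerm_ne_top :
    ∫⁻ ω, ∑' n : ℕ, oddTerm Y lam (n + 1) ω ^ (3 : ℝ) ∂P ≠ ∞ := by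
  rw [lintegral_tsum fun n => (aemeasurable_oddTerm hY (by omega)).pow_const _]
  refine ne_top_of_le_ne_top ?_ (ENNReal.tsum_le_tsum fun n =>
    lintegral_oddTerm_rpow_le hlam hY (n := n + 1) (by omega) (p := 3) (by norm_num) le_rfl)
  rw [ENNReal.tsum_mul_right]
  exact ENNReal.mul_ne_top (tsum_coe_rpow_succ_ne_top (by norm_num)) cubeBound_ne_top

/-- Series with finite expectation converge almost surely, so their terms tend to zero. The exponent
`1/24` is one choice below `1/6`. -/
theorem ae_tendsto_fullSeq :
    ∀ᵐ ω ∂P, Tendsto (fun n => fullSeq Y lam n ω) atTop (𝓝 0) := by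
  have h1 := ae_lt_top' (.tsum fun n => aemeasurable_jointTerm hY (by omega) (1 / 24))
    (lintegral_tsum_jointTerm_ne_top hlam hY (p := 1 / 24) (by norm_num))
  have h2 := ae_lt_top' (.tsum fun n =>
    (aemeasurable_oddTerm hY (n := n + 1) (by omega)).pow_const _)
    (lintegral_tsum_oddTerm_ne_top hlam hY)
  have h3 : ∀ᵐ ω ∂P, ∀ n : ℕ, ‖fullSeq Y lam (n + 1) ω‖ₑ ^ (1 / 24 : ℝ) ≤
      jointTerm Y lam (1 / 24) (n + 1) ω + oddTerm Y lam (n + 1) ω ^ (1 / 24 : ℝ) :=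
    ae_all_iff.2 fun n =>
      ae_enorm_fullSeq_rpow_le_add hlam hY (by omega) (by norm_num) (by norm_num)
  filter_upwards [h1, h2, h3] with ω h1 h2 h3
  rw [← tendsto_add_atTop_iff_nat 1, tendsto_iff_enorm_sub_tendsto_zero]
  simp only [sub_zero]
  have t1 := ENNReal.tendsto_atTop_zero_of_tsum_ne_top h1.ne
  have t2 := ENNReal.tendsto_atTop_zero_of_tsum_ne_top h2.ne
  -- The cubes tend to zero; the power `1/72` turns exponent `3` into `1/24`.
  have t3 : Tendsto (fun n : ℕ => oddTerm Y lam (n + 1) ω ^ (1 / 24 : ℝ)) atTop (𝓝 0) := by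
    have := t2.ennrpow_const (1 / 72)
    simpa only [← ENNReal.rpow_mul, ENNReal.zero_rpow_of_pos (by norm_num : (0 : ℝ) < 1 / 72),
      show (3 : ℝ) * (1 / 72) = 1 / 24 by norm_num] using this
  have t4 : Tendsto (fun n : ℕ => ‖fullSeq Y lam (n + 1) ω‖ₑ ^ (1 / 24 : ℝ)) atTop (𝓝 0) := by
    refine tendsto_of_tendsto_of_tendsto_of_le_of_le tendsto_const_nhds ?_
      (fun n => zero_le) h3
    simpa using t1.add t3
  have := t4.ennrpow_const 24
  simp only [← ENNReal.rpow_mul] at this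
  norm_num at this
  exact this

/-- At `p = 5/2` the two exponents are `-17/16 + 15/16` and `-5/16 - 15/16`. -/
theorem lintegral_enorm_fullSeq_rpow_le {n : ℕ} (hn : 1 ≤ n) :
    ∫⁻ ω, ‖fullSeq Y lam n ω‖ₑ ^ (5 / 2 : ℝ) ∂P ≤
      (((n : ℝ≥0) ^ (-(1 / 8) : ℝ) : ℝ≥0) : ℝ≥0∞) * cubeBound ^ 2 +
        (((n : ℝ≥0) ^ (-(5 / 4) : ℝ) : ℝ≥0) : ℝ≥0∞) * cubeBound := by
  refine (lintegral_mono_ae (ae_enorm_fullSeq_rpow_le_add hlam hY hn (p := 5 / 2)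
    (by norm_num) (by norm_num))).trans ?_
  rw [lintegral_add_left' (aemeasurable_jointTerm hY hn _)]
  refine add_le_add ((lintegral_jointTerm_le hlam hY hn _).trans_eq ?_)
    ((lintegral_oddTerm_rpow_le hlam hY hn (by norm_num) (by norm_num)).trans_eq ?_)
  all_goals norm_num

theorem memLp_fullSeq {n : ℕ} (hn : 1 ≤ n) : MemLp (fullSeq Y lam n) (5 / 2) P := by
  refine ⟨(hY.aemeasurable_fullSeq hn).aestronglyMeasurable, ?_⟩
  rw [eLpNorm_fullSeq]
  refine ENNReal.rpow_lt_top_of_nonneg (by norm_num)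
    (ne_top_of_le_ne_top ?_ (lintegral_enorm_fullSeq_rpow_le hlam hY hn))
  exact ENNReal.add_ne_top.2 ⟨ENNReal.mul_ne_top (by simp) (ENNReal.pow_ne_top cubeBound_ne_top),
    ENNReal.mul_ne_top (by simp) cubeBound_ne_top⟩

theorem tendsto_eLpNorm_fullSeq :
    Tendsto (fun n => eLpNorm (fullSeq Y lam n) (5 / 2) P) atTop (𝓝 0) := by
  have t1 := ENNReal.Tendsto.mul_const (b := cubeBound ^ 2)
    (tendsto_coe_rpow_atTop_zero (c := -(1 / 8)) (by norm_num))
    (.inr (ENNReal.pow_ne_top cubeBound_ne_top))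
  have t2 := ENNReal.Tendsto.mul_const (b := cubeBound)
    (tendsto_coe_rpow_atTop_zero (c := -(5 / 4)) (by norm_num)) (.inr cubeBound_ne_top)
  have t3 : Tendsto (fun n => ∫⁻ ω, ‖fullSeq Y lam n ω‖ₑ ^ (5 / 2 : ℝ) ∂P) atTop (𝓝 0) := by
    refine tendsto_of_tendsto_of_tendsto_of_le_of_le' tendsto_const_nhds
      (by simpa only [zero_mul, add_zero] using t1.add t2) (.of_forall fun n => zero_le) ?_
    filter_upwards [eventually_ge_atTop 1] with n hn
    exact lintegral_enorm_fullSeq_rpow_le hlam hY hn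
  simp_rw [eLpNorm_fullSeq]
  simpa using t3.ennrpow_const (2 / 5)

/-- The supremum of the joint terms is bounded by their sum. For the odd terms, `x^δ ≤ 1 + x³`
replaces the small power by the summable one. The argument covers all `δ < 1/6`. -/
theorem lintegral_iSup_enorm_fullSeq_rpow_lt_top [IsProbabilityMeasure P] {δ : ℝ} (h0 : 0 < δ)
    (h1 : δ < 1 / 6) :
    ∫⁻ ω, (⨆ n : ℕ, ⨆ _ : 1 ≤ n, ‖fullSeq Y lam n ω‖ₑ) ^ δ ∂P < ∞ := by
  have h3 : ∀ᵐ ω ∂P, ∀ n : ℕ, ‖fullSeq Y lam (n + 1) ω‖ₑ ^ δ ≤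
      jointTerm Y lam δ (n + 1) ω + oddTerm Y lam (n + 1) ω ^ δ :=
    ae_all_iff.2 fun n =>
      ae_enorm_fullSeq_rpow_le_add hlam hY (by omega) h0 (by linarith)
  have hle : ∀ᵐ ω ∂P, (⨆ n : ℕ, ⨆ _ : 1 ≤ n, ‖fullSeq Y lam n ω‖ₑ) ^ δ ≤
      ∑' n : ℕ, jointTerm Y lam δ (n + 1) ω +
        (1 + ∑' n : ℕ, oddTerm Y lam (n + 1) ω ^ (3 : ℝ)) := by
    filter_upwards [h3] with ω h3
    rw [← ENNReal.le_rpow_inv_iff h0]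
    refine iSup₂_le fun n hn => ?_
    rw [ENNReal.le_rpow_inv_iff h0]
    obtain ⟨m, rfl⟩ := Nat.exists_eq_add_of_le' hn
    refine (h3 m).trans (add_le_add (ENNReal.le_tsum m) ?_)
    rcases le_total (oddTerm Y lam (m + 1) ω) 1 with h | h
    · exact (ENNReal.rpow_le_one h h0.le).trans le_self_add
    · exact (ENNReal.rpow_le_rpow_of_exponent_le h (by linarith)).trans
        ((ENNReal.le_tsum m).trans le_add_self)
  refine (lintegral_mono_ae hle).trans_lt ?_
  rw [lintegral_add_left' (.tsum fun n => aemeasurable_jointTerm hY (by omega) δ),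
    lintegral_add_left' aemeasurable_const]
  refine ENNReal.add_lt_top.2 ⟨(lintegral_tsum_jointTerm_ne_top hlam hY h1).lt_top,
    ENNReal.add_lt_top.2 ⟨by simp, (lintegral_tsum_oddTerm_ne_top hlam hY).lt_top⟩⟩

end SpecialParameters

/-! ### Almost sure divergence of the first-order parts -/

section Divergence

variable {Ω : Type*} [MeasurableSpace Ω] {P : Measure Ω} {Y : ℕ → Ω → ℝ} {lam : ℕ → ℝ≥0}

theorem iIndepSet_preimage {ι : Type*} {f : ι → Ω → ℝ} (hf : iIndepFun f P) {s : Set ℝ}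
    (hs : MeasurableSet s) : iIndepSet (fun i => f i ⁻¹' s) P := by
  rw [iIndepSet_iff_iIndep]
  refine iIndep_of_iIndep_of_le hf.iIndep fun i => ?_
  refine MeasurableSpace.generateFrom_le fun t ht => ?_
  rw [Set.mem_singleton_iff.1 ht]
  exact ⟨s, hs, rfl⟩

/-- Second Borel-Cantelli lemma, with the divergent series of `n^{-3/4}`. The `Y_n` are only almost
everywhere measurable, so the events are formed from measurable modifications. -/
theorem ae_frequently_one_le (hlam : IsSpecial lam) (hY : IsIndepPoissonSeq Y lam P) :
    ∀ᵐ ω ∂P, ∃ᶠ n : ℕ in atTop, 1 ≤ Y (2 * (n + 1)) ω := by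
  have hm : ∀ n, AEMeasurable (Y (n + 1)) P := fun n => hY.aemeasurable (by omega)
  have hind : iIndepFun (fun n : ℕ => (hm (2 * n + 1)).mk) P :=
    (hY.1.congr fun n => (hm n).ae_eq_mk).precomp (g := fun n : ℕ => 2 * n + 1)
      fun a b h => by simpa using h
  have := hind.isProbabilityMeasure
  have hs : ∀ n : ℕ, MeasurableSet ((hm (2 * n + 1)).mk ⁻¹' Set.Ici 1) := fun n =>
    (hm (2 * n + 1)).measurable_mk measurableSet_Ici
  have hP : ∀ n : ℕ, ENNReal.ofReal (Real.exp (-1)) *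
      ((((n + 1 : ℕ) : ℝ≥0) ^ (-(3 / 4) : ℝ) : ℝ≥0) : ℝ≥0∞) ≤
        P ((hm (2 * n + 1)).mk ⁻¹' Set.Ici 1) := fun n => by
    rw [← hlam.even (n + 1) (by omega)]
    obtain ⟨-, ha1⟩ := pos_and_le_one_of_eq_rpow (by omega) (by norm_num)
      (hlam.even (n + 1) (by omega))
    exact le_measure_one_le ((hY.2 (2 * (n + 1)) (by omega)).congr (hm (2 * n + 1)).ae_eq_mk.symm)
      ha1
  have hsum : ∑' n : ℕ, P ((hm (2 * n + 1)).mk ⁻¹' Set.Ici 1) = ∞ := by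
    refine top_unique (le_trans (top_le_iff.2 ?_) (ENNReal.tsum_le_tsum hP))
    rw [ENNReal.tsum_mul_left]
    refine ENNReal.mul_eq_top.2 (.inl ⟨by simp [Real.exp_pos], ?_⟩)
    by_contra h
    rw [← ne_eq, ENNReal.tsum_coe_ne_top_iff_summable,
      NNReal.summable_nat_add_iff (f := fun n : ℕ => (n : ℝ≥0) ^ (-(3 / 4) : ℝ)) 1,
      NNReal.summable_rpow] at h
    norm_num at h
  have h1 := measure_limsup_eq_one hs (iIndepSet_preimage hind measurableSet_Ici) hsum
  have h2 : ∀ᵐ ω ∂P, ω ∈ limsup (fun n : ℕ => (hm (2 * n + 1)).mk ⁻¹' Set.Ici 1) atTop :=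
    (mem_ae_iff_prob_eq_one (.measurableSet_limsup hs)).2 h1
  have h3 : ∀ᵐ ω ∂P, ∀ n : ℕ, Y (2 * n + 1 + 1) ω = (hm (2 * n + 1)).mk _ ω :=
    ae_all_iff.2 fun n => (hm (2 * n + 1)).ae_eq_mk
  filter_upwards [h2, h3] with ω h2 h3
  rw [mem_limsup_iff_frequently_mem] at h2
  refine h2.mono fun n hn => ?_
  rw [show 2 * (n + 1) = 2 * n + 1 + 1 by ring, h3 n]
  exact hn

/-- Here `λ_{2n+1} / √λ_{2n} = n^{1/16} ≥ 1`. At `n = 1` one has `λ_2 = 1` and the lower bound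
degenerates to zero, hence `n ≥ 2`. -/
theorem le_firstPart {Ω : Type*} {Y : ℕ → Ω → ℝ} {lam : ℕ → ℝ≥0} (hlam : IsSpecial lam)
    {n : ℕ} (hn : 2 ≤ n) {ω : Ω} (hω : 1 ≤ Y (2 * n) ω) :
    1 - (2 : ℝ) ^ (-(3 / 4) : ℝ) ≤ firstPart Y lam n ω := by
  have hn0 : (0 : ℝ) < n := by exact_mod_cast (by omega : 0 < n)
  have hn2 : (2 : ℝ) ≤ n := by exact_mod_cast hn
  have hc : (2 : ℝ) ^ (-(3 / 4) : ℝ) ≤ 1 :=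
    Real.rpow_le_one_of_one_le_of_nonpos (by norm_num) (by norm_num)
  simp only [firstPart, standardized]
  rw [hlam.even n (by omega), hlam.odd n (by omega)]
  simp only [NNReal.coe_rpow, NNReal.coe_natCast]
  have h1 : (n : ℝ) ^ (-(3 / 4) : ℝ) ≤ (2 : ℝ) ^ (-(3 / 4) : ℝ) :=
    Real.rpow_le_rpow_of_nonpos (by norm_num) hn2 (by norm_num)
  have h2 : √((n : ℝ) ^ (-(3 / 4) : ℝ)) = (n : ℝ) ^ (-(3 / 8) : ℝ) := by
    rw [Real.sqrt_eq_rpow, ← Real.rpow_mul hn0.le]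
    norm_num
  have h3 : (n : ℝ) ^ (-(5 / 16) : ℝ) / (n : ℝ) ^ (-(3 / 8) : ℝ) = (n : ℝ) ^ (1 / 16 : ℝ) := by
    rw [← Real.rpow_sub hn0]
    norm_num
  have h4 : 1 ≤ (n : ℝ) ^ (1 / 16 : ℝ) :=
    Real.one_le_rpow (by linarith) (by norm_num)
  rw [h2, mul_div_assoc', mul_comm, mul_div_assoc, h3]
  nlinarith

theorem ae_not_tendsto_firstPart (hlam : IsSpecial lam) (hY : IsIndepPoissonSeq Y lam P) :
    ∀ᵐ ω ∂P, ¬ Tendsto (fun n => firstPart Y lam n ω) atTop (𝓝 0) := by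
  filter_upwards [ae_frequently_one_le hlam hY] with ω hω h
  have hc : (2 : ℝ) ^ (-(3 / 4) : ℝ) < 1 :=
    Real.rpow_lt_one_of_one_lt_of_neg (by norm_num) (by norm_num)
  have h1 : ∀ᶠ n : ℕ in atTop, firstPart Y lam (n + 1) ω < 1 - (2 : ℝ) ^ (-(3 / 4) : ℝ) :=
    ((tendsto_add_atTop_iff_nat 1).2 h).eventually_lt_const (by linarith)
  obtain ⟨n, hn1, hn2, hn3⟩ := (hω.and_eventually (h1.and (eventually_ge_atTop 1))).exists
  exact absurd hn2 (not_lt.2 (le_firstPart hlam (by omega) hn1))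

end Divergence

/-! ### Lebesgue measure on the half-line and the cells -/

section HalfLine

theorem halfLine_apply (s : Set ℝ≥0) : halfLine s = volume ((↑) '' s : Set ℝ) :=
  (MeasurableEmbedding.subtype_coe (measurableSet_Ici (a := (0 : ℝ)))).comap_apply _ _

theorem halfLine_Ioc (a b : ℝ≥0) : halfLine (Set.Ioc a b) = ((b - a : ℝ≥0) : ℝ≥0∞) := by
  have h : ((↑) '' Set.Ioc a b : Set ℝ) = Set.Ioc (a : ℝ) b := by
    ext x
    constructor
    · rintro ⟨y, hy, rfl⟩
      exact_mod_cast hy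
    · intro hx
      exact ⟨⟨x, a.2.trans hx.1.le⟩, hx, rfl⟩
  rw [halfLine_apply, h, Real.volume_Ioc, ← ENNReal.ofReal_coe_nnreal]
  rcases le_total a b with hab | hab
  · rw [NNReal.coe_sub hab]
  · rw [tsub_eq_zero_of_le hab, ENNReal.ofReal_of_nonpos (by simpa using hab)]
    simp

theorem halfLine_Ico (a b : ℝ≥0) : halfLine (Set.Ico a b) = ((b - a : ℝ≥0) : ℝ≥0∞) := by
  have h : ((↑) '' Set.Ico a b : Set ℝ) = Set.Ico (a : ℝ) b := by
    ext x
    constructor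
    · rintro ⟨y, hy, rfl⟩
      exact_mod_cast hy
    · intro hx
      exact ⟨⟨x, a.2.trans hx.1⟩, hx, rfl⟩
  rw [halfLine_apply, h, Real.volume_Ico, ← ENNReal.ofReal_coe_nnreal]
  rcases le_total a b with hab | hab
  · rw [NNReal.coe_sub hab]
  · rw [tsub_eq_zero_of_le hab, ENNReal.ofReal_of_nonpos (by simpa using hab)]
    simp

instance : SigmaFinite halfLine :=
  ⟨⟨{ set := fun n => Set.Ico 0 n
      set_mem := fun _ => trivial
      finite := fun n => by rw [halfLine_Ico]; exact ENNReal.coe_lt_top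
      spanning := by
        refine Set.eq_univ_of_forall fun x => Set.mem_iUnion.2 ?_
        obtain ⟨n, hn⟩ := exists_nat_gt x
        exact ⟨n, zero_le, hn⟩ }⟩⟩

variable (lam : ℕ → ℝ≥0)

theorem measurableSet_cell (n : ℕ) : MeasurableSet (cell lam n) := measurableSet_Ioc

theorem halfLine_cell {n : ℕ} (hn : 1 ≤ n) : halfLine (cell lam n) = lam n := by
  rw [cell, halfLine_Ioc, ← Finset.Ico_add_one_right_eq_Icc, Finset.sum_Ico_succ_top hn,
    add_tsub_cancel_left]

theorem disjoint_cell {m n : ℕ} (hmn : m < n) : Disjoint (cell lam m) (cell lam n) := by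
  refine Set.disjoint_left.2 fun x hx hx' => ?_
  have h : ∑ i ∈ Finset.Icc 1 m, lam i ≤ ∑ i ∈ Finset.Ico 1 n, lam i :=
    Finset.sum_le_sum_of_subset fun i hi => by
      simp only [Finset.mem_Icc, Finset.mem_Ico] at hi ⊢
      omega
  exact absurd (hx'.1.trans_le (hx.2.trans h)) (lt_irrefl _)

theorem pairwise_disjoint_cell : Pairwise fun m n => Disjoint (cell lam m) (cell lam n) :=
  fun _ _ h => h.lt_or_gt.elim (disjoint_cell lam) fun h => (disjoint_cell lam h).symm

end HalfLine

/-! ### Moments and independence of compensated counts -/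

section Counts

variable {Ω X : Type*} [MeasurableSpace Ω] [MeasurableSpace X] {N : Ω → Measure X} {μ : Measure X}
  {P : Measure Ω}

namespace IsPoissonProcess

theorem measurable_apply (hN : IsPoissonProcess N μ P) {A : Set X} (hA : MeasurableSet A) :
    Measurable fun ω => N ω A :=
  (Measure.measurable_coe hA).comp hN.measurable

/-- Independence of a family is a statement about its finite subfamilies, and each of these can be
enumerated by some `Fin m`. -/
theorem iIndepFun_apply (hN : IsPoissonProcess N μ P) {ι : Type*} {B : ι → Set X}
    (hB : ∀ i, MeasurableSet (B i)) (hd : Pairwise fun i j => Disjoint (B i) (B j)) :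
    iIndepFun (fun i ω => N ω (B i)) P := by
  rw [iIndepFun_iff_finset]
  intro s
  have h := hN.indep s.card (fun i => B (s.equivFin.symm i)) (fun i => hB _)
    fun i j hij => hd fun h => hij (s.equivFin.symm.injective (Subtype.ext h))
  have h' := h.precomp (g := s.equivFin) s.equivFin.injective
  simpa [Function.comp_def, Finset.restrict_def] using h'

theorem hasLaw_toReal (hN : IsPoissonProcess N μ P) {A : Set X} (hA : MeasurableSet A)
    (hfin : μ A ≠ ∞) : HasLaw (fun ω => (N ω A).toReal)
      ((poissonMeasure (μ A).toNNReal).map (Nat.cast : ℕ → ℝ)) P := by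
  refine HasLaw.fun_comp (Y := ENNReal.toReal) ⟨by fun_prop, ?_⟩ (hN.law A hA hfin)
  rw [Measure.map_map ENNReal.measurable_toReal .of_discrete]
  congr 1

theorem ae_ne_top (hN : IsPoissonProcess N μ P) {A : Set X} (hA : MeasurableSet A)
    (hfin : μ A ≠ ∞) : ∀ᵐ ω ∂P, N ω A ≠ ∞ := by
  have hm : MeasurableSet {x : ℝ≥0∞ | x ≠ ∞} := (measurableSet_singleton _).compl
  rw [(hN.law A hA hfin).ae_iff (p := fun x => x ≠ ∞) hm.mem]
  refine (ae_map_iff .of_discrete hm).2 ?_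
  exact .of_forall fun n => ENNReal.natCast_ne_top n

theorem measurable_compensated (hN : IsPoissonProcess N μ P) {A : Set X} (hA : MeasurableSet A) :
    Measurable (compensated N μ A) :=
  (hN.measurable_apply hA).ennreal_toReal.sub_const _

theorem memLp_compensated [IsFiniteMeasure P] (hN : IsPoissonProcess N μ P) {A : Set X}
    (hA : MeasurableSet A) (hfin : μ A ≠ ∞) (k : ℕ) : MemLp (compensated N μ A) k P :=
  (memLp_of_hasLaw (hN.hasLaw_toReal hA hfin) k).sub (memLp_const _)

theorem memLp_two_compensated [IsFiniteMeasure P] (hN : IsPoissonProcess N μ P) {A : Set X}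
    (hA : MeasurableSet A) (hfin : μ A ≠ ∞) : MemLp (compensated N μ A) 2 P := by
  exact_mod_cast hN.memLp_compensated hA hfin 2

theorem integral_compensated [IsProbabilityMeasure P] (hN : IsPoissonProcess N μ P) {A : Set X}
    (hA : MeasurableSet A) (hfin : μ A ≠ ∞) : ∫ ω, compensated N μ A ω ∂P = 0 := by
  have hl := hN.hasLaw_toReal hA hfin
  have hi : Integrable (fun ω => (N ω A).toReal) P :=
    memLp_one_iff_integrable.1 (by simpa using memLp_of_hasLaw hl 1)
  simp only [compensated]
  rw [integral_sub hi (integrable_const _), integral_of_hasLaw hl]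
  simp [ENNReal.coe_toNNReal_eq_toReal]

/-- Additivity passes through `toReal` only where `N(A)` is finite, hence the almost sure form. -/
theorem compensated_ae_eq_inter_add_diff (hN : IsPoissonProcess N μ P) {A B : Set X}
    (hA : MeasurableSet A) (hB : MeasurableSet B) (hfin : μ A ≠ ∞) :
    compensated N μ A =ᵐ[P]
      fun ω => compensated N μ (A ∩ B) ω + compensated N μ (A \ B) ω := by
  filter_upwards [hN.ae_ne_top hA hfin] with ω hω
  simp only [compensated]
  rw [← measure_inter_add_sdiff A hB (μ := N ω), ← measure_inter_add_sdiff A hB (μ := μ),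
    ENNReal.toReal_add, ENNReal.toReal_add]
  · ring
  · exact measure_ne_top_of_subset Set.inter_subset_left hfin
  · exact measure_ne_top_of_subset Set.sdiff_subset hfin
  · exact measure_ne_top_of_subset Set.inter_subset_left hω
  · exact measure_ne_top_of_subset Set.sdiff_subset hω

theorem iIndepFun_compensated (hN : IsPoissonProcess N μ P) {ι : Type*} {B : ι → Set X}
    (hB : ∀ i, MeasurableSet (B i)) (hd : Pairwise fun i j => Disjoint (B i) (B j)) :
    iIndepFun (fun i => compensated N μ (B i)) P :=
  (hN.iIndepFun_apply hB hd).comp (fun i x => x.toReal - (μ (B i)).toReal)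
    fun i => by fun_prop

/-- The pair of counts on `B₁` and `B₂` is independent of the count on `A`, and the latter is
centred. -/
theorem integral_mul_compensated_eq_zero [IsProbabilityMeasure P] (hN : IsPoissonProcess N μ P)
    {B₁ B₂ A : Set X} (h₁ : MeasurableSet B₁) (h₂ : MeasurableSet B₂) (hA : MeasurableSet A)
    (h₁₂ : Disjoint B₁ B₂) (h₁A : Disjoint B₁ A) (h₂A : Disjoint B₂ A) (hfin : μ A ≠ ∞)
    {g : ℝ × ℝ → ℝ} (hg : Measurable g) :
    ∫ ω, g (compensated N μ B₁ ω, compensated N μ B₂ ω) * compensated N μ A ω ∂P = 0 := by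
  have hm : ∀ i : Fin 3, MeasurableSet (![B₁, B₂, A] i) := by
    intro i
    fin_cases i <;> assumption
  have hd : Pairwise fun i j : Fin 3 => Disjoint (![B₁, B₂, A] i) (![B₁, B₂, A] j) := by
    intro i j hij
    fin_cases i <;> fin_cases j <;> first | exact absurd rfl hij | assumption | (symm; assumption)
  have h := (hN.iIndepFun_compensated hm hd).indepFun_prodMk
    (fun i => hN.measurable_compensated (hm i)) 0 1 2 (by decide) (by decide)
  have h' := h.comp hg measurable_id
  have hm1 := hN.measurable_compensated h₁
  have hm2 := hN.measurable_compensated h₂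
  have := IndepFun.integral_fun_mul_eq_mul_integral h'
    (hg.comp (hm1.prodMk hm2)).aestronglyMeasurable
    (hN.measurable_compensated hA).aestronglyMeasurable
  refine this.trans ?_
  simp only [Function.comp_def, id_eq]
  refine mul_eq_zero_of_right _ ?_
  exact hN.integral_compensated hA hfin

theorem memLp_two_mul [IsProbabilityMeasure P] (hN : IsPoissonProcess N μ P)
    {A B : Set X} (hA : MeasurableSet A) (hB : MeasurableSet B) (hAf : μ A ≠ ∞) (hBf : μ B ≠ ∞) :
    MemLp (fun ω => compensated N μ A ω * compensated N μ B ω) 2 P := by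
  have : ENNReal.HolderTriple 4 4 2 := ⟨by
    rw [← two_mul, show (4 : ℝ≥0∞) = 2 * 2 by norm_num,
      ENNReal.mul_inv (by simp) (by simp), ← mul_assoc, ENNReal.mul_inv_cancel (by simp) (by simp),
      one_mul]⟩
  exact MemLp.mul' (hN.memLp_compensated hB hBf 4) (hN.memLp_compensated hA hAf 4)

/-- Cut `B` into its parts in `A`, in `A'` and outside both. In each case a centred factor is
independent of the rest: the count of `A'`, of `A`, and of the outer part, respectively. -/
theorem integral_mul_mul_eq_zero [IsProbabilityMeasure P] (hN : IsPoissonProcess N μ P)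
    {A A' B : Set X} (hA : MeasurableSet A) (hA' : MeasurableSet A') (hB : MeasurableSet B)
    (hAf : μ A ≠ ∞) (hAf' : μ A' ≠ ∞) (hBf : μ B ≠ ∞) (hd : Disjoint A A') :
    ∫ ω, compensated N μ A ω * compensated N μ A' ω * compensated N μ B ω ∂P = 0 := by
  have hint : ∀ {C : Set X}, MeasurableSet C → μ C ≠ ∞ → Integrable
      (fun ω => compensated N μ A ω * compensated N μ A' ω * compensated N μ C ω) P :=
    fun hC hCf => (hN.memLp_two_mul hA hA' hAf hAf').integrable_mul
      (hN.memLp_two_compensated hC hCf)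
  -- the part of `B` inside one of the two sets contributes nothing
  have key : ∀ {D D' : Set X}, MeasurableSet D → MeasurableSet D' → μ D ≠ ∞ → μ D' ≠ ∞ →
      Disjoint D D' → ∫ ω, compensated N μ D ω * compensated N μ D' ω *
        compensated N μ (D ∩ B) ω ∂P = 0 := by
    intro D D' hD hD' hDf hDf' hDD
    rw [← hN.integral_mul_compensated_eq_zero (B₁ := D ∩ B) (B₂ := D \ B) (A := D')
      (hD.inter hB) (hD.diff hB) hD' Set.disjoint_sdiff_inter.symm
      (hDD.mono_left Set.inter_subset_left) (hDD.mono_left Set.sdiff_subset) hDf'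
      (g := fun z => (z.1 + z.2) * z.1) (by fun_prop)]
    refine integral_congr_ae ?_
    filter_upwards [hN.compensated_ae_eq_inter_add_diff hD hB hDf] with ω hω
    rw [hω]
    ring
  have hBA : μ (B \ A) ≠ ∞ := measure_ne_top_of_subset Set.sdiff_subset hBf
  have e1 := hN.compensated_ae_eq_inter_add_diff hB hA hBf
  have e2 := hN.compensated_ae_eq_inter_add_diff (hB.diff hA) hA' hBA
  have hs1 : B ∩ A = A ∩ B := Set.inter_comm _ _
  have hs2 : (B \ A) ∩ A' = A' ∩ B := by
    ext x
    simp only [Set.mem_inter_iff, Set.mem_sdiff]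
    exact ⟨fun h => ⟨h.2, h.1.1⟩, fun h => ⟨⟨h.2, fun hx => Set.disjoint_left.1 hd hx h.1⟩, h.1⟩⟩
  rw [hs1] at e1
  rw [hs2] at e2
  have m1 : μ (A ∩ B) ≠ ∞ := measure_ne_top_of_subset Set.inter_subset_left hAf
  have m2 : μ (A' ∩ B) ≠ ∞ := measure_ne_top_of_subset Set.inter_subset_left hAf'
  have m3 : μ ((B \ A) \ A') ≠ ∞ := measure_ne_top_of_subset Set.sdiff_subset hBA
  calc ∫ ω, compensated N μ A ω * compensated N μ A' ω * compensated N μ B ω ∂P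
      = ∫ ω, (compensated N μ A ω * compensated N μ A' ω * compensated N μ (A ∩ B) ω +
          (compensated N μ A ω * compensated N μ A' ω * compensated N μ (A' ∩ B) ω +
          compensated N μ A ω * compensated N μ A' ω * compensated N μ ((B \ A) \ A') ω)) ∂P := by
        refine integral_congr_ae ?_
        filter_upwards [e1, e2] with ω h1 h2
        rw [h1, h2]
        ring
    _ = 0 := by
        have i1 := hint (hA.inter hB) m1
        have i2 := hint (hA'.inter hB) m2
        have i3 := hint ((hB.diff hA).diff hA') m3
        rw [integral_add i1 (by exact i2.add i3), integral_add i2 i3, key hA hA' hAf hAf' hd]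
        have k2 := key hA' hA hAf' hAf hd.symm
        simp_rw [mul_comm (compensated N μ A' _) (compensated N μ A _)] at k2
        rw [k2]
        have k3 := hN.integral_mul_compensated_eq_zero hA hA' ((hB.diff hA).diff hA') hd
          (Set.disjoint_left.2 fun x hx h => h.1.2 hx)
          (Set.disjoint_left.2 fun x hx h => h.2 hx) m3 (g := fun z => z.1 * z.2) (by fun_prop)
        simp only at k3
        rw [k3]
        simp

end IsPoissonProcess

end Counts

/-! ### Membership in a chaos and orthogonality -/

section ChaosMembership

variable {Ω X : Type*} [MeasurableSpace Ω] [MeasurableSpace X] {N : Ω → Measure X} {μ : Measure X}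
  {P : Measure Ω}

theorem memLp_sum_indicator_pi [SigmaFinite μ] {p : ℕ} {A : Fin p → Set X}
    (hA : ∀ i, MeasurableSet (A i)) (hfin : ∀ i, μ (A i) ≠ ∞) :
    MemLp (fun x : Fin p → X => ∑ σ : Equiv.Perm (Fin p),
      (Set.univ.pi A).indicator (fun _ => (1 : ℝ)) (x ∘ σ)) 2 (Measure.pi fun _ : Fin p => μ) := by
  refine memLp_finsetSum _ fun σ _ => ?_
  have h : (fun x : Fin p → X => (Set.univ.pi A).indicator (fun _ => (1 : ℝ)) (x ∘ σ)) =
      (Set.univ.pi fun i => A (σ.symm i)).indicator fun _ => 1 := by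
    ext x
    have : x ∘ σ ∈ Set.univ.pi A ↔ x ∈ Set.univ.pi fun i => A (σ.symm i) := by
      simp only [Set.mem_univ_pi, Function.comp_apply]
      exact ⟨fun h i => by simpa using h (σ.symm i), fun h i => by simpa using h (σ i)⟩
    by_cases hx : x ∘ σ ∈ Set.univ.pi A
    · rw [Set.indicator_of_mem hx, Set.indicator_of_mem (this.1 hx)]
    · rw [Set.indicator_of_notMem hx, Set.indicator_of_notMem (mt this.2 hx)]
  rw [h]
  refine memLp_indicator_const 2 (.univ_pi fun i => hA _) 1 (.inr ?_)
  rw [Measure.pi_pi]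
  exact ENNReal.prod_ne_top fun i _ => hfin _

theorem toLp_mem_chaos [SigmaFinite μ] {p : ℕ} {A : Fin p → Set X}
    (hA : ∀ i, MeasurableSet (A i)) (hfin : ∀ i, μ (A i) ≠ ∞)
    (hd : Pairwise fun i j => Disjoint (A i) (A j))
    (hg : MemLp (fun ω => (p.factorial : ℝ) * ∏ i, compensated N μ (A i) ω) 2 P) :
    hg.toLp ∈ chaos N μ P p := by
  refine Submodule.mem_map.2 ⟨((memLp_sum_indicator_pi hA hfin).toLp, hg.toLp), ?_, rfl⟩
  refine Submodule.le_topologicalClosure _ (Submodule.subset_span ?_)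
  exact ⟨A, hA, hfin, hd, (memLp_sum_indicator_pi hA hfin).coeFn_toLp, hg.coeFn_toLp⟩

/-- The functional `z ↦ ⟨G, z.2⟩` is continuous on the product space, so its kernel is closed and
contains the whole graph once it contains the elementary pairs. -/
theorem mem_orthogonal_chaos {p : ℕ} {G : Lp ℝ 2 P}
    (hG : ∀ z ∈ elementaryPairs N μ P p, inner ℝ z.2 G = 0) : G ∈ (chaos N μ P p)ᗮ := by
  rw [Submodule.mem_orthogonal]
  rintro u ⟨z, hz, rfl⟩
  let L : (Lp ℝ 2 (Measure.pi fun _ : Fin p => μ) × Lp ℝ 2 P) →L[ℝ] ℝ :=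
    (innerSL ℝ G).comp (ContinuousLinearMap.snd ℝ _ _)
  have hle : multipleIntegralGraph N μ P p ≤ LinearMap.ker L.toLinearMap := by
    refine Submodule.topologicalClosure_minimal _ (Submodule.span_le.2 fun w hw => ?_)
      L.isClosed_ker
    change inner ℝ G w.2 = 0
    rw [real_inner_comm]
    exact hG w hw
  have h : inner ℝ G z.2 = 0 := hle hz
  rw [real_inner_comm] at h
  exact h

theorem IsPoissonProcess.mem_orthogonal_chaos_one [IsProbabilityMeasure P]
    (hN : IsPoissonProcess N μ P) {A A' : Set X} (hA : MeasurableSet A) (hA' : MeasurableSet A')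
    (hAf : μ A ≠ ∞) (hAf' : μ A' ≠ ∞) (hd : Disjoint A A') {G : Lp ℝ 2 P} {c : ℝ}
    (hG : G =ᵐ[P] fun ω => c * (compensated N μ A ω * compensated N μ A' ω)) :
    G ∈ (chaos N μ P 1)ᗮ := by
  refine mem_orthogonal_chaos ?_
  rintro z ⟨B, hB, hBf, -, -, hz⟩
  rw [L2.inner_def]
  calc ∫ ω, inner ℝ (z.2 ω) (G ω) ∂P
      = ∫ ω, c * (compensated N μ A ω * compensated N μ A' ω * compensated N μ (B 0) ω) ∂P := by
        refine integral_congr_ae ?_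
        filter_upwards [hG, hz] with ω h1 h2
        rw [h1, h2]
        simp
        ring
    _ = 0 := by
        rw [integral_const_mul, hN.integral_mul_mul_eq_zero hA hA' (hB 0) hAf hAf' (hBf 0) hd,
          mul_zero]

theorem IsPoissonProcess.toLp_compensated_mem_chaos_one [SigmaFinite μ] [IsProbabilityMeasure P]
    (hN : IsPoissonProcess N μ P) {A : Set X} (hA : MeasurableSet A) (hAf : μ A ≠ ∞) :
    (hN.memLp_two_compensated hA hAf).toLp ∈ chaos N μ P 1 := by
  have e : (fun ω => ((1 : ℕ).factorial : ℝ) * ∏ i : Fin 1, compensated N μ ((fun _ => A) i) ω) =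
      compensated N μ A := by
    ext ω
    simp
  have h : MemLp (fun ω => ((1 : ℕ).factorial : ℝ) *
      ∏ i : Fin 1, compensated N μ ((fun _ => A) i) ω) 2 P := by
    rw [e]
    exact hN.memLp_two_compensated hA hAf
  have := toLp_mem_chaos (fun _ => hA) (fun _ => hAf) (fun i j hij =>
    absurd (Subsingleton.elim i j) hij) h
  convert this using 2
  exact e.symm

theorem IsPoissonProcess.toLp_mul_mem_chaos_two [SigmaFinite μ] [IsProbabilityMeasure P]
    (hN : IsPoissonProcess N μ P) {A A' : Set X} (hA : MeasurableSet A) (hA' : MeasurableSet A')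
    (hAf : μ A ≠ ∞) (hAf' : μ A' ≠ ∞) (hd : Disjoint A A') :
    (hN.memLp_two_mul hA hA' hAf hAf').toLp ∈ chaos N μ P 2 := by
  have e : (fun ω => ((2 : ℕ).factorial : ℝ) * ∏ i : Fin 2, compensated N μ (![A, A'] i) ω) =
      (2 : ℝ) • fun ω => compensated N μ A ω * compensated N μ A' ω := by
    ext ω
    simp [Fin.prod_univ_two]
  have hm2 := hN.memLp_two_mul hA hA' hAf hAf'
  have h : MemLp (fun ω => ((2 : ℕ).factorial : ℝ) *
      ∏ i : Fin 2, compensated N μ (![A, A'] i) ω) 2 P := by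
    rw [e]
    exact hm2.const_smul 2
  have hmem := toLp_mem_chaos (A := ![A, A']) (by simp [Fin.forall_fin_two, hA, hA'])
    (by simp [Fin.forall_fin_two, hAf, hAf'])
    (fun i j hij => by
      fin_cases i <;> fin_cases j <;>
        first | exact absurd rfl hij | exact hd | exact hd.symm) h
  have e2 : h.toLp = (2 : ℝ) • hm2.toLp :=
    (MemLp.toLp_congr _ _ (.of_eq e)).trans (MemLp.toLp_const_smul 2 hm2)
  rw [e2] at hmem
  -- The elementary pair carries the factor `2!`, which is divided out.
  simpa using Submodule.smul_mem _ (2⁻¹ : ℝ) hmem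

end ChaosMembership

/-! ### The chaos decomposition of `F_n` -/

section CellCount

theorem standardized_cellCount {Ω : Type*} {N : Ω → Measure ℝ≥0} {lam : ℕ → ℝ≥0} {n : ℕ}
    (hn : 1 ≤ n) (ω : Ω) :
    standardized (cellCount N lam) lam n ω =
      (√(lam n))⁻¹ * compensated N halfLine (cell lam n) ω := by
  rw [standardized, compensated, halfLine_cell lam hn, cellCount, ENNReal.coe_toReal]
  ring

variable {Ω : Type*} [MeasurableSpace Ω] {P : Measure Ω} {N : Ω → Measure ℝ≥0}

theorem IsPoissonProcess.isIndepPoissonSeq_cellCount (hN : IsPoissonProcess N halfLine P)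
    (lam : ℕ → ℝ≥0) : IsIndepPoissonSeq (cellCount N lam) lam P := by
  constructor
  · exact (hN.iIndepFun_apply (B := fun n => cell lam (n + 1)) (fun n => measurableSet_cell lam _)
      fun i j hij => pairwise_disjoint_cell lam (by simpa using hij)).comp
      (fun _ => ENNReal.toReal) fun _ => ENNReal.measurable_toReal
  · intro n hn
    have h := hN.hasLaw_toReal (measurableSet_cell lam n)
      (by rw [halfLine_cell lam hn]; exact ENNReal.coe_ne_top)
    rwa [halfLine_cell lam hn, ENNReal.toNNReal_coe] at h

/-- `F_n` is `c₁` times a compensated count plus `c₂` times a product over two disjoint cells; the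
second piece is orthogonal to the first chaos, so the projection returns the first piece. -/
theorem IsPoissonProcess.fullSeq_chaos [IsProbabilityMeasure P] (hN : IsPoissonProcess N halfLine P)
    (lam : ℕ → ℝ≥0) {n : ℕ} (hn : 1 ≤ n) :
    ∃ h : MemLp (fullSeq (cellCount N lam) lam n) 2 P,
      h.toLp ∈ chaosUpTo N halfLine P 2 ∧
      chaosProj N halfLine P 1 h.toLp =ᵐ[P] firstPart (cellCount N lam) lam n := by
  have hA := measurableSet_cell lam (2 * n)
  have hA' := measurableSet_cell lam (2 * n + 1)
  have hAf : halfLine (cell lam (2 * n)) ≠ ∞ := by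
    rw [halfLine_cell lam (by omega)]; exact ENNReal.coe_ne_top
  have hAf' : halfLine (cell lam (2 * n + 1)) ≠ ∞ := by
    rw [halfLine_cell lam (by omega)]; exact ENNReal.coe_ne_top
  have hd : Disjoint (cell lam (2 * n)) (cell lam (2 * n + 1)) := disjoint_cell lam (by omega)
  have h1 := hN.memLp_two_compensated hA hAf
  have h2 := hN.memLp_two_mul hA hA' hAf hAf'
  set c₁ : ℝ := lam (2 * n + 1) * (√(lam (2 * n)))⁻¹ with hc₁
  set c₂ : ℝ := √(lam (2 * n + 1)) * (√(lam (2 * n)))⁻¹ * (√(lam (2 * n + 1)))⁻¹ with hc₂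
  have e1 : firstPart (cellCount N lam) lam n =
      c₁ • compensated N halfLine (cell lam (2 * n)) := by
    ext ω
    rw [firstPart, standardized_cellCount (by omega), Pi.smul_apply, smul_eq_mul, hc₁, mul_assoc]
  have e2 : fullSeq (cellCount N lam) lam n = c₁ • compensated N halfLine (cell lam (2 * n)) +
      c₂ • fun ω => compensated N halfLine (cell lam (2 * n)) ω *
        compensated N halfLine (cell lam (2 * n + 1)) ω := by
    ext ω
    rw [fullSeq, standardized_cellCount (by omega), standardized_cellCount (by omega)]
    simp only [Pi.add_apply, Pi.smul_apply, smul_eq_mul, hc₁, hc₂]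
    ring
  have hF : MemLp (fullSeq (cellCount N lam) lam n) 2 P := by
    rw [e2]
    exact (h1.const_smul c₁).add (h2.const_smul c₂)
  have e3 : hF.toLp = c₁ • h1.toLp + c₂ • h2.toLp := by
    rw [← MemLp.toLp_const_smul, ← MemLp.toLp_const_smul, ← MemLp.toLp_add]
    exact MemLp.toLp_congr _ _ (.of_eq e2)
  have m1 : c₁ • h1.toLp ∈ chaos N halfLine P 1 :=
    Submodule.smul_mem _ _ (hN.toLp_compensated_mem_chaos_one hA hAf)
  have m2 : c₂ • h2.toLp ∈ chaos N halfLine P 2 :=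
    Submodule.smul_mem _ _ (hN.toLp_mul_mem_chaos_two hA hA' hAf hAf' hd)
  have hle : ∀ p ≤ 2, chaos N halfLine P p ≤ chaosUpTo N halfLine P 2 := fun p hp =>
    le_iSup₂_of_le (f := fun p (_ : p ≤ 2) => chaos N halfLine P p) p hp le_rfl
  refine ⟨hF, ?_, ?_⟩
  · rw [e3]
    exact Submodule.add_mem _ (hle 1 (by norm_num) m1) (hle 2 le_rfl m2)
  · have hproj : chaosProj N halfLine P 1 hF.toLp = c₁ • h1.toLp := by
      refine Submodule.eq_starProjection_of_mem_orthogonal'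
        (Submodule.le_topologicalClosure _ m1) ?_ e3
      rw [Submodule.orthogonal_closure]
      refine Submodule.smul_mem _ _ ?_
      refine hN.mem_orthogonal_chaos_one hA hA' hAf hAf' hd (c := 1) ?_
      filter_upwards [h2.coeFn_toLp] with ω hω
      rw [hω, one_mul]
    rw [hproj, e1]
    filter_upwards [Lp.coeFn_smul c₁ h1.toLp, h1.coeFn_toLp] with ω hω hω'
    rw [hω, Pi.smul_apply, Pi.smul_apply, hω']

end CellCount

/-! ### One block: a Poisson number of i.i.d. points -/

section Block

variable {X : Type*} [MeasurableSpace X]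

/-- The law of a Poisson number (with parameter one) and an independent i.i.d. sequence of points
with law `ρ`. -/
def blockMeasure (ρ : Measure X) [IsProbabilityMeasure ρ] : Measure (ℕ × (ℕ → X)) :=
  (poissonMeasure 1).prod (Measure.infinitePi fun _ : ℕ => ρ)

instance (ρ : Measure X) [IsProbabilityMeasure ρ] : IsProbabilityMeasure (blockMeasure ρ) := by
  unfold blockMeasure
  infer_instance

/-- The number of the first `z.1` points of `z.2` that lie in `B`. -/
def blockCount (B : Set X) (z : ℕ × (ℕ → X)) : ℕ :=
  ∑ i ∈ Finset.range z.1, B.indicator (fun _ => 1) (z.2 i)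

/-- The counting measure of the first `z.1` points of `z.2`. -/
def blockPoints (z : ℕ × (ℕ → X)) : Measure X :=
  ∑ i ∈ Finset.range z.1, Measure.dirac (z.2 i)

theorem blockPoints_apply {B : Set X} (hB : MeasurableSet B) (z : ℕ × (ℕ → X)) :
    blockPoints z B = blockCount B z := by
  simp only [blockPoints, blockCount, Measure.coe_finsetSum, Finset.sum_apply, Nat.cast_sum]
  refine Finset.sum_congr rfl fun i _ => ?_
  rw [Measure.dirac_apply' _ hB]
  by_cases h : z.2 i ∈ B <;> simp [h]

theorem measurable_blockCount {B : Set X} (hB : MeasurableSet B) :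
    Measurable (blockCount B) := by
  refine measurable_from_prod_countable_right fun k => ?_
  unfold blockCount
  have h : Measurable (B.indicator fun _ => (1 : ℕ)) := measurable_const.indicator hB
  exact Finset.measurable_sum (Finset.range k) fun i _ => h.comp (measurable_pi_apply i)

variable {ι : Type*} [Fintype ι] {B : ι → Set X}

/-- The character `x ↦ exp (i ∑ j, t j 1_{B j}(x))`. -/
def blockChar (B : ι → Set X) (t : ι → ℝ) (x : X) : ℂ :=
  Complex.exp (((∑ j, (B j).indicator (fun _ => t j) x : ℝ) : ℂ) * Complex.I)

theorem measurable_blockChar (hB : ∀ j, MeasurableSet (B j)) (t : ι → ℝ) :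
    Measurable (blockChar B t) := by
  have : Measurable fun x => ∑ j, (B j).indicator (fun _ => t j) x :=
    Finset.measurable_sum _ fun j _ => measurable_const.indicator (hB j)
  unfold blockChar
  fun_prop

/-- By disjointness at most one indicator is nonzero at `x`, so the exponential of the sum becomes a
sum. -/
theorem blockChar_eq {X ι : Type*} [Fintype ι] {B : ι → Set X}
    (hd : Pairwise fun i j => Disjoint (B i) (B j)) (t : ι → ℝ) (x : X) :
    blockChar B t x =
      1 + ∑ j, (B j).indicator (fun _ => Complex.exp (t j * Complex.I) - 1) x := by
  by_cases hx : ∃ j, x ∈ B j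
  · obtain ⟨j, hj⟩ := hx
    have hne : ∀ i, i ≠ j → x ∉ B i := fun i hij hi => Set.disjoint_left.1 (hd hij) hi hj
    rw [blockChar, Finset.sum_eq_single j (fun i _ hi => Set.indicator_of_notMem (hne i hi) _)
      (by simp), Finset.sum_eq_single j (fun i _ hi => Set.indicator_of_notMem (hne i hi) _)
      (by simp), Set.indicator_of_mem hj, Set.indicator_of_mem hj]
    ring
  · have hne : ∀ j, x ∉ B j := fun j hj => hx ⟨j, hj⟩
    simp [blockChar, hne]

theorem integral_blockChar (ρ : Measure X) [IsProbabilityMeasure ρ]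
    (hB : ∀ j, MeasurableSet (B j)) (hd : Pairwise fun i j => Disjoint (B i) (B j))
    (t : ι → ℝ) : ∫ x, blockChar B t x ∂ρ =
      1 + ∑ j, (ρ.real (B j) : ℂ) * (Complex.exp (t j * Complex.I) - 1) := by
  simp_rw [blockChar_eq hd]
  have hi : ∀ j ∈ Finset.univ, Integrable
      ((B j).indicator fun _ => Complex.exp (t j * Complex.I) - 1) ρ :=
    fun j _ => (integrable_const _).indicator (hB j)
  rw [integral_add (integrable_const _) (integrable_finsetSum _ hi), integral_finsetSum _ hi]
  simp [integral_indicator_const _ (hB _)]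

theorem exp_sum_blockCount {X ι : Type*} [Fintype ι] {B : ι → Set X} (t : ι → ℝ) (z : ℕ × (ℕ → X)) :
    Complex.exp (((∑ j, (blockCount (B j) z : ℝ) * t j : ℝ) : ℂ) * Complex.I) =
      ∏ i : Fin z.1, blockChar B t (z.2 i) := by
  simp only [blockChar]
  rw [← Complex.exp_sum, ← Finset.sum_mul, ← Complex.ofReal_sum,
    ← Finset.sum_range (fun i => ∑ j, (B j).indicator (fun _ => t j) (z.2 i)), Finset.sum_comm]
  congr 3
  refine Finset.sum_congr rfl fun j _ => ?_
  rw [blockCount, Nat.cast_sum, Finset.sum_mul]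
  refine Finset.sum_congr rfl fun i _ => ?_
  by_cases h : z.2 i ∈ B j <;> simp [h]

/-- Given the number `k` of points, independence yields `φ^k` with `φ = ∫ blockChar`; averaging over
the Poisson number gives `exp(φ - 1)`. Since `φ - 1` is a sum over `j`, the result factorises, which
yields both the laws and the independence. -/
theorem integral_exp_sum_blockCount (ρ : Measure X) [IsProbabilityMeasure ρ]
    (hB : ∀ j, MeasurableSet (B j)) (hd : Pairwise fun i j => Disjoint (B i) (B j))
    (t : ι → ℝ) :
    ∫ z, Complex.exp (((∑ j, (blockCount (B j) z : ℝ) * t j : ℝ) : ℂ) * Complex.I)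
      ∂blockMeasure ρ =
      ∏ j, Complex.exp ((ρ.real (B j) : ℂ) * (Complex.exp (t j * Complex.I) - 1)) := by
  have hm : Measurable fun z : ℕ × (ℕ → X) =>
      Complex.exp (((∑ j, (blockCount (B j) z : ℝ) * t j : ℝ) : ℂ) * Complex.I) := by
    have : ∀ j, Measurable fun z : ℕ × (ℕ → X) => (blockCount (B j) z : ℝ) := fun j =>
      Measurable.of_discrete.comp (measurable_blockCount (hB j))
    fun_prop
  have hint : Integrable (fun z : ℕ × (ℕ → X) =>
      Complex.exp (((∑ j, (blockCount (B j) z : ℝ) * t j : ℝ) : ℂ) * Complex.I))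
      ((poissonMeasure 1).prod (Measure.infinitePi fun _ : ℕ => ρ)) :=
    (integrable_const (1 : ℝ)).mono hm.aestronglyMeasurable
      (.of_forall fun z => by rw [Complex.norm_exp_ofReal_mul_I]; simp)
  rw [blockMeasure, integral_prod _ hint]
  have hind : iIndepFun (fun (i : ℕ) (u : ℕ → X) => u i) (Measure.infinitePi fun _ : ℕ => ρ) :=
    iIndepFun_infinitePi (P := fun _ : ℕ => ρ) (X := fun _ x => x) fun _ => measurable_id
  have hk : ∀ k : ℕ, ∫ u, Complex.exp (((∑ j, (blockCount (B j) (k, u) : ℝ) * t j : ℝ) : ℂ) *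
      Complex.I) ∂(Measure.infinitePi fun _ : ℕ => ρ) = (∫ x, blockChar B t x ∂ρ) ^ k := by
    intro k
    simp_rw [exp_sum_blockCount]
    rw [(hind.precomp (g := ((↑) : Fin k → ℕ)) Fin.val_injective).integral_fun_prod_comp
      (f := fun _ => blockChar B t) (fun i => (measurable_pi_apply _).aemeasurable)
      (fun i => (measurable_blockChar hB t).aestronglyMeasurable)]
    have : ∀ i : Fin k, ∫ u : ℕ → X, blockChar B t (u i) ∂(Measure.infinitePi fun _ : ℕ => ρ) =
        ∫ x, blockChar B t x ∂ρ := fun i =>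
      (measurePreserving_eval_infinitePi (fun _ : ℕ => ρ) (i : ℕ)).hasLaw.integral_comp
        (measurable_blockChar hB t).aestronglyMeasurable
    simp [this]
  simp_rw [hk]
  rw [integral_poissonMeasure, integral_blockChar ρ hB hd, ← Complex.exp_sum]
  set w : ℂ := ∑ j, (ρ.real (B j) : ℂ) * (Complex.exp (t j * Complex.I) - 1)
  have h : ∀ n : ℕ, (Real.exp (-((1 : ℝ≥0) : ℝ)) * ((1 : ℝ≥0) : ℝ) ^ n / n.factorial) •
      (1 + w) ^ n = Complex.exp (-1) * ((1 + w) ^ n / n.factorial) := fun n => by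
    rw [Complex.real_smul]
    push_cast
    ring
  simp_rw [h]
  rw [tsum_mul_left, (NormedSpace.expSeries_div_hasSum_exp (1 + w)).tsum_eq,
    ← Complex.exp_eq_exp_ℂ, ← Complex.exp_add]
  congr 1
  ring

theorem hasLaw_blockCount (ρ : Measure X) [IsProbabilityMeasure ρ] {A : Set X}
    (hA : MeasurableSet A) : HasLaw (fun z => (blockCount A z : ℝ))
      ((poissonMeasure (ρ A).toNNReal).map (Nat.cast : ℕ → ℝ)) (blockMeasure ρ) := by
  have hm : Measurable fun z : ℕ × (ℕ → X) => (blockCount A z : ℝ) :=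
    Measurable.of_discrete.comp (measurable_blockCount hA)
  refine ⟨hm.aemeasurable, ?_⟩
  have := Measure.isProbabilityMeasure_map (μ := blockMeasure ρ) hm.aemeasurable
  refine Measure.ext_of_charFun ?_
  ext t
  rw [charFun_map_cast_poissonMeasure, charFun_apply_real,
    integral_map hm.aemeasurable (by fun_prop)]
  have h := integral_exp_sum_blockCount (ι := Unit) (B := fun _ => A) ρ (fun _ => hA)
    (fun i j hij => absurd (Subsingleton.elim i j) hij) fun _ => t
  simp only [Finset.univ_unique, Finset.sum_singleton, Finset.prod_singleton] at h
  refine Eq.trans ?_ h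
  congr with z
  push_cast
  ring_nf

theorem iIndepFun_blockCount (ρ : Measure X) [IsProbabilityMeasure ρ]
    (hB : ∀ j, MeasurableSet (B j)) (hd : Pairwise fun i j => Disjoint (B i) (B j)) :
    iIndepFun (fun j z => (blockCount (B j) z : ℝ)) (blockMeasure ρ) := by
  have hm : ∀ j, Measurable fun z : ℕ × (ℕ → X) => (blockCount (B j) z : ℝ) := fun j =>
    Measurable.of_discrete.comp (measurable_blockCount (hB j))
  rw [iIndepFun_iff_charFun_pi fun j => (hm j).aemeasurable]
  intro t
  have hm' : Measurable fun z : ℕ × (ℕ → X) =>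
      WithLp.toLp 2 fun j => (blockCount (B j) z : ℝ) :=
    (WithLp.measurable_toLp 2 _).comp (measurable_pi_lambda _ hm)
  rw [charFun_apply, integral_map hm'.aemeasurable (by fun_prop)]
  simp_rw [(hasLaw_blockCount ρ (hB _)).map_eq, charFun_map_cast_poissonMeasure]
  refine Eq.trans ?_ ((integral_exp_sum_blockCount ρ hB hd t).trans ?_)
  · congr with z
    simp [PiLp.inner_apply, mul_comm]
  · rfl

end Block

/-! ### Countable sums of independent Poisson counts -/

section CountableSums

variable {Ω : Type*} [MeasurableSpace Ω] {P : Measure Ω}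

/-- If the doubly indexed family `(Z i j)` is independent, so are the families `(Z i j)_j`. -/
theorem iIndepFun_curry {ι κ 𝓧 : Type*} [MeasurableSpace 𝓧] {Z : ι → κ → Ω → 𝓧}
    (hZ : ∀ i j, Measurable (Z i j)) (h : iIndepFun (fun (p : ι × κ) ω => Z p.1 p.2 ω) P) :
    iIndepFun (fun i ω j => Z i j ω) P := by
  have := h.isProbabilityMeasure
  have : ∀ i j, IsProbabilityMeasure (P.map (Z i j)) := fun i j =>
    Measure.isProbabilityMeasure_map (hZ i j).aemeasurable
  have hrow : ∀ i, P.map (fun ω j => Z i j ω) = Measure.infinitePi fun j => P.map (Z i j) :=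
    fun i => (iIndepFun_iff_map_fun_eq_infinitePi_map (hZ i)).1
      (h.precomp (g := Prod.mk i) (Prod.mk_right_injective i))
  rw [iIndepFun_iff_map_fun_eq_infinitePi_map fun i => measurable_pi_lambda _ (hZ i)]
  simp_rw [hrow]
  rw [← Measure.infinitePi_map_curry (fun i j => P.map (Z i j)),
    ← (iIndepFun_iff_map_fun_eq_infinitePi_map (fun p : ι × κ => hZ p.1 p.2)).1 h,
    Measure.map_map (MeasurableEquiv.measurable _)
      (measurable_pi_lambda _ fun p : ι × κ => hZ p.1 p.2)]
  rfl

variable {C : ℕ → Ω → ℕ} {a : ℕ → ℝ≥0}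

theorem charFun_sum_range
    (hlaw : ∀ k, HasLaw (fun ω => (C k ω : ℝ)) ((poissonMeasure (a k)).map Nat.cast) P)
    (hind : iIndepFun (fun k ω => (C k ω : ℝ)) P) (n : ℕ) (t : ℝ) :
    ∫ ω, Complex.exp (t * (∑ k ∈ Finset.range n, (C k ω : ℝ) : ℝ) * Complex.I) ∂P =
      Complex.exp ((∑ k ∈ Finset.range n, (a k : ℝ) : ℝ) *
        (Complex.exp (t * Complex.I) - 1)) := by
  have hm : ∀ k, AEMeasurable (fun ω => (C k ω : ℝ)) P := fun k => (hlaw k).aemeasurable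
  have h := hind.restrict (Finset.range n) |>.charFun_map_fun_finsetSum_eq_prod fun k _ => hm k
  have h' := congrFun h t
  rw [charFun_apply_real, integral_map (Finset.aemeasurable_fun_sum _ fun k _ => hm k)
    (by fun_prop)] at h'
  rw [h', Finset.prod_apply]
  simp_rw [(hlaw _).map_eq, charFun_map_cast_poissonMeasure]
  rw [← Complex.exp_sum, ← Finset.sum_mul]
  push_cast
  rfl

/-- The total has finite expectation, hence is almost surely finite and is the limit of its partial
sums. Dominated convergence passes their Poisson characteristic functions to the limit; the law then
transfers from real to extended values. -/
theorem hasLaw_tsum_of_summable [IsProbabilityMeasure P]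
    (hlaw : ∀ k, HasLaw (fun ω => (C k ω : ℝ)) ((poissonMeasure (a k)).map Nat.cast) P)
    (hC : ∀ k, Measurable (C k)) (hind : iIndepFun (fun k ω => (C k ω : ℝ)) P)
    (ha : Summable a) :
    HasLaw (fun ω => ∑' k, (C k ω : ℝ≥0∞)) ((poissonMeasure (∑' k, a k)).map Nat.cast) P := by
  have hCm : ∀ k, Measurable fun ω => (C k ω : ℝ≥0∞) := fun k =>
    Measurable.of_discrete.comp (hC k)
  have hSm : Measurable fun ω => ∑' k, (C k ω : ℝ≥0∞) := .tsum hCm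
  have hk : ∀ k, ∫⁻ ω, (C k ω : ℝ≥0∞) ∂P = a k := fun k => by
    have hi : Integrable (fun ω => (C k ω : ℝ)) P :=
      memLp_one_iff_integrable.1 (by simpa using memLp_of_hasLaw (hlaw k) 1)
    have h := ofReal_integral_eq_lintegral_ofReal hi (.of_forall fun ω => by positivity)
    rw [integral_of_hasLaw (hlaw k)] at h
    simpa using h.symm
  have hfin : ∀ᵐ ω ∂P, ∑' k, (C k ω : ℝ≥0∞) ≠ ∞ := by
    refine (ae_lt_top hSm ?_).mono fun ω h => h.ne
    rw [lintegral_tsum fun k => (hCm k).aemeasurable]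
    simp_rw [hk]
    exact ENNReal.tsum_coe_ne_top_iff_summable.2 ha
  have hlim : ∀ᵐ ω ∂P, Tendsto (fun n => ∑ k ∈ Finset.range n, (C k ω : ℝ)) atTop
      (𝓝 (∑' k, (C k ω : ℝ≥0∞)).toReal) := by
    filter_upwards [hfin] with ω hω
    have h := (ENNReal.hasSum_toReal hω).tendsto_sum_nat
    rw [← ENNReal.tsum_toReal_eq fun k => ENNReal.natCast_ne_top _] at h
    simpa using h
  have hreal : P.map (fun ω => (∑' k, (C k ω : ℝ≥0∞)).toReal) =
      (poissonMeasure (∑' k, a k)).map (Nat.cast : ℕ → ℝ) := by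
    have := Measure.isProbabilityMeasure_map (μ := P) hSm.ennreal_toReal.aemeasurable
    refine Measure.ext_of_charFun ?_
    ext t
    rw [charFun_map_cast_poissonMeasure, charFun_apply_real,
      integral_map hSm.ennreal_toReal.aemeasurable (by fun_prop)]
    have t1 : Tendsto (fun n => ∫ ω, Complex.exp (t * (∑ k ∈ Finset.range n, (C k ω : ℝ) : ℝ) *
        Complex.I) ∂P) atTop
        (𝓝 (∫ ω, Complex.exp (t * ((∑' k, (C k ω : ℝ≥0∞)).toReal : ℝ) * Complex.I) ∂P)) := by
      refine tendsto_integral_of_dominated_convergence (fun _ => 1) (fun n => ?_)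
        (integrable_const _) (fun n => .of_forall fun ω => ?_) ?_
      · have : Measurable fun ω => ∑ k ∈ Finset.range n, (C k ω : ℝ) :=
          Finset.measurable_sum _ fun k _ => Measurable.of_discrete.comp (hC k)
        exact Measurable.aestronglyMeasurable (by fun_prop)
      · rw [← Complex.ofReal_mul, Complex.norm_exp_ofReal_mul_I]
      · filter_upwards [hlim] with ω hω
        have hc : Continuous fun x : ℝ => Complex.exp (t * x * Complex.I) := by fun_prop
        exact (hc.tendsto _).comp hω
    have t2 : Tendsto (fun n => Complex.exp ((∑ k ∈ Finset.range n, (a k : ℝ) : ℝ) *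
        (Complex.exp (t * Complex.I) - 1))) atTop
        (𝓝 (Complex.exp ((∑' k, a k : ℝ≥0) * (Complex.exp (t * Complex.I) - 1)))) := by
      have hc : Continuous fun x : ℝ => Complex.exp (x * (Complex.exp (t * Complex.I) - 1)) := by
        fun_prop
      have hs : Tendsto (fun n => ∑ k ∈ Finset.range n, (a k : ℝ)) atTop
          (𝓝 ((∑' k, a k : ℝ≥0) : ℝ)) :=
        (NNReal.hasSum_coe.2 ha.hasSum).tendsto_sum_nat
      exact (hc.tendsto _).comp hs
    simp_rw [charFun_sum_range hlaw hind] at t1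
    exact tendsto_nhds_unique t1 t2
  have hR : HasLaw (fun ω => (∑' k, (C k ω : ℝ≥0∞)).toReal)
      ((poissonMeasure (∑' k, a k)).map (Nat.cast : ℕ → ℝ)) P :=
    ⟨hSm.ennreal_toReal.aemeasurable, hreal⟩
  have hE : HasLaw ENNReal.ofReal ((poissonMeasure (∑' k, a k)).map (Nat.cast : ℕ → ℝ≥0∞))
      ((poissonMeasure (∑' k, a k)).map (Nat.cast : ℕ → ℝ)) := by
    refine ⟨by fun_prop, ?_⟩
    rw [Measure.map_map ENNReal.measurable_ofReal .of_discrete]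
    congr 1
    ext n
    simp
  refine (hE.fun_comp hR).congr ?_
  filter_upwards [hfin] with ω hω
  rw [ENNReal.ofReal_toReal hω]

/-- By the second Borel-Cantelli lemma infinitely many counts are at least `1`, whereas the terms of
a finite sum tend to zero. -/
theorem ae_tsum_eq_top
    (hlaw : ∀ k, HasLaw (fun ω => (C k ω : ℝ)) ((poissonMeasure (a k)).map Nat.cast) P)
    (hC : ∀ k, Measurable (C k)) (hind : iIndepFun (fun k ω => (C k ω : ℝ)) P)
    (ha1 : ∀ k, a k ≤ 1) (ha : ∑' k, (a k : ℝ≥0∞) = ∞) :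
    ∀ᵐ ω ∂P, ∑' k, (C k ω : ℝ≥0∞) = ∞ := by
  have := hind.isProbabilityMeasure
  have hs : ∀ k, MeasurableSet ((fun ω => (C k ω : ℝ)) ⁻¹' Set.Ici 1) := fun k =>
    (Measurable.of_discrete.comp (hC k)) measurableSet_Ici
  have hsum : ∑' k, P ((fun ω => (C k ω : ℝ)) ⁻¹' Set.Ici 1) = ∞ := by
    refine top_unique (le_trans (top_le_iff.2 ?_)
      (ENNReal.tsum_le_tsum fun k => le_measure_one_le (hlaw k) (ha1 k)))
    rw [ENNReal.tsum_mul_left, ha]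
    exact ENNReal.mul_top (by simp [Real.exp_pos])
  have h1 := measure_limsup_eq_one hs (iIndepSet_preimage hind measurableSet_Ici) hsum
  have h2 : ∀ᵐ ω ∂P, ω ∈ limsup (fun k => (fun ω => (C k ω : ℝ)) ⁻¹' Set.Ici 1) atTop :=
    (mem_ae_iff_prob_eq_one (.measurableSet_limsup hs)).2 h1
  filter_upwards [h2] with ω hω
  rw [mem_limsup_iff_frequently_mem] at hω
  by_contra hne
  have h3 := (ENNReal.tendsto_atTop_zero_of_tsum_ne_top hne).eventually_lt_const one_pos
  obtain ⟨k, hk1, hk2⟩ := (hω.and_eventually h3).exists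
  have h4 : (1 : ℝ) ≤ C k ω := hk1
  have h5 : C k ω < 1 := by exact_mod_cast hk2
  have h6 : 1 ≤ C k ω := by exact_mod_cast h4
  omega

end CountableSums

/-! ### Existence of a Poisson process and the counterexample -/

section Existence

variable {X : Type*} [MeasurableSpace X]

/-- The superposition of the point configurations of all blocks. -/
def superposition (ω : ℕ → ℕ × (ℕ → X)) : Measure X :=
  Measure.sum fun k => blockPoints (ω k)

theorem superposition_apply {B : Set X} (hB : MeasurableSet B) (ω : ℕ → ℕ × (ℕ → X)) :
    superposition ω B = ∑' k, (blockCount B (ω k) : ℝ≥0∞) := by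
  simp_rw [superposition, Measure.sum_apply _ hB, blockPoints_apply hB]

/-- A set has mass at most one in each block, so the countable-sum results cover finite and infinite
total mass alike. For disjoint sets, all counts indexed by block and set are jointly independent;
grouping them by set gives independent totals. -/
theorem isPoissonProcess_superposition (ρ : ℕ → Measure X) [∀ k, IsProbabilityMeasure (ρ k)] :
    IsPoissonProcess superposition (Measure.sum ρ)
      (Measure.infinitePi fun k => blockMeasure (ρ k)) := by
  set P := Measure.infinitePi fun k => blockMeasure (ρ k)
  have hmeas : ∀ {B : Set X}, MeasurableSet B → ∀ k,
      Measurable fun ω : ℕ → ℕ × (ℕ → X) => blockCount B (ω k) := fun hB k =>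
    (measurable_blockCount hB).comp (measurable_pi_apply k)
  have hmeasR : ∀ {B : Set X}, MeasurableSet B → ∀ k,
      Measurable fun ω : ℕ → ℕ × (ℕ → X) => (blockCount B (ω k) : ℝ) := fun hB k =>
    Measurable.of_discrete.comp (hmeas hB k)
  have heval : ∀ k, HasLaw (fun ω : ℕ → ℕ × (ℕ → X) => ω k) (blockMeasure (ρ k)) P := fun k =>
    (measurePreserving_eval_infinitePi (fun k => blockMeasure (ρ k)) k).hasLaw
  have hlaw : ∀ {B : Set X}, MeasurableSet B → ∀ k,
      HasLaw (fun ω => (blockCount B (ω k) : ℝ))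
        ((poissonMeasure (ρ k B).toNNReal).map Nat.cast) P := fun hB k =>
    (hasLaw_blockCount (ρ k) hB).fun_comp (heval k)
  have hind : ∀ {B : Set X}, MeasurableSet B →
      iIndepFun (fun k ω => (blockCount B (ω k) : ℝ)) P := fun {B} hB =>
    iIndepFun_infinitePi (P := fun k => blockMeasure (ρ k))
      (X := fun _ z => (blockCount B z : ℝ)) fun _ =>
        Measurable.of_discrete.comp (measurable_blockCount hB)
  have hcoe : ∀ (B : Set X) k, ((ρ k B).toNNReal : ℝ≥0∞) = ρ k B := fun B k =>
    ENNReal.coe_toNNReal (measure_ne_top _ _)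
  have hsum : ∀ {B : Set X}, MeasurableSet B →
      Measure.sum ρ B = ∑' k, ((ρ k B).toNNReal : ℝ≥0∞) := fun hB => by
    simp_rw [hcoe, Measure.sum_apply _ hB]
  refine ⟨?_, fun ω => ⟨fun k => blockPoints (ω k),
    fun k B hB => ⟨_, blockPoints_apply hB _⟩, rfl⟩, fun B hB hfin => ?_, fun B hB htop => ?_,
    fun m B hB hd => ?_⟩
  · refine Measure.measurable_of_measurable_coe _ fun B hB => ?_
    simp_rw [superposition_apply hB]
    exact .tsum fun k => Measurable.of_discrete.comp (hmeas hB k)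
  · simp_rw [superposition_apply hB]
    rw [hsum hB] at hfin ⊢
    have ha := ENNReal.tsum_coe_ne_top_iff_summable.1 hfin
    rw [← ENNReal.coe_tsum ha, ENNReal.toNNReal_coe]
    exact hasLaw_tsum_of_summable (hlaw hB) (hmeas hB) (hind hB) ha
  · simp_rw [superposition_apply hB]
    rw [hsum hB] at htop
    refine ae_tsum_eq_top (hlaw hB) (hmeas hB) (hind hB) (fun k => ?_) htop
    rw [← ENNReal.coe_le_coe, hcoe]
    exact prob_le_one
  · have hall : iIndepFun (fun (p : ℕ × Fin m) (ω : ℕ → ℕ × (ℕ → X)) =>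
        (blockCount (B p.2) (ω p.1) : ℝ)) P := by
      refine iIndepFun_uncurry' (X := fun k j (ω : ℕ → ℕ × (ℕ → X)) =>
        (blockCount (B j) (ω k) : ℝ)) (fun k j => hmeasR (hB j) k) ?_ fun k => ?_
      · exact iIndepFun_infinitePi (P := fun k => blockMeasure (ρ k))
          (X := fun _ z j => (blockCount (B j) z : ℝ)) fun _ =>
            measurable_pi_lambda _ fun j =>
              Measurable.of_discrete.comp (measurable_blockCount (hB j))
      · have hBm : ∀ j, Measurable fun z : ℕ × (ℕ → X) => (blockCount (B j) z : ℝ) := fun j =>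
          Measurable.of_discrete.comp (measurable_blockCount (hB j))
        have : IsProbabilityMeasure (P.map fun ω => ω k) :=
          Measure.isProbabilityMeasure_map (measurable_pi_apply k).aemeasurable
        have h := iIndepFun_blockCount (ρ k) hB hd
        rw [← (heval k).map_eq, iIndepFun_iff_map_fun_eq_infinitePi_map hBm,
          Measure.map_map (measurable_pi_lambda _ hBm) (measurable_pi_apply k)] at h
        rw [iIndepFun_iff_map_fun_eq_infinitePi_map fun j => hmeasR (hB j) k]
        refine h.trans ?_
        congr 1
        ext1 j
        exact Measure.map_map (hBm j) (measurable_pi_apply k)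
    -- Exchange the roles of block and set, so that each row collects the counts of one set over all
    -- blocks.
    have hswap := hall.precomp (g := Prod.swap) Prod.swap_injective
    have hcurry := iIndepFun_curry (Z := fun (j : Fin m) (k : ℕ) (ω : ℕ → ℕ × (ℕ → X)) =>
      (blockCount (B j) (ω k) : ℝ)) (fun j k => hmeasR (hB j) k) hswap
    have h := hcurry.comp (fun _ (x : ℕ → ℝ) => ∑' k, ENNReal.ofReal (x k)) fun _ => by fun_prop
    convert h using 2 with j
    ext ω
    simp [superposition_apply (hB j)]

/-- Unit intervals `[k, k+1)` cut the half-line into countably many probability measures. -/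
theorem exists_isPoissonProcess_halfLine :
    ∃ (Ω : Type) (_ : MeasurableSpace Ω) (P : Measure Ω) (_ : IsProbabilityMeasure P)
      (N : Ω → Measure ℝ≥0), IsPoissonProcess N halfLine P := by
  have hprob : ∀ k : ℕ, IsProbabilityMeasure (halfLine.restrict (Set.Ico (k : ℝ≥0) (k + 1))) :=
    fun k => ⟨by rw [Measure.restrict_apply_univ, halfLine_Ico, add_tsub_cancel_left]; simp⟩
  have hsum : Measure.sum (fun k : ℕ => halfLine.restrict (Set.Ico (k : ℝ≥0) (k + 1))) =
      halfLine := by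
    rw [← Measure.restrict_iUnion _ fun k => measurableSet_Ico]
    · have hU : ⋃ k : ℕ, Set.Ico (k : ℝ≥0) (k + 1) = Set.univ :=
        Set.eq_univ_of_forall fun x => Set.mem_iUnion.2
          ⟨⌊x⌋₊, Nat.floor_le zero_le, Nat.lt_floor_add_one x⟩
      rw [hU, Measure.restrict_univ]
    · intro i j hij
      refine Set.disjoint_left.2 fun x hx hx' => hij ?_
      rw [← (Nat.floor_eq_iff zero_le).2 ⟨hx.1, hx.2⟩, (Nat.floor_eq_iff zero_le).2 ⟨hx'.1, hx'.2⟩]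
  have h := isPoissonProcess_superposition
    fun k : ℕ => halfLine.restrict (Set.Ico (k : ℝ≥0) (k + 1))
  rw [hsum] at h
  exact ⟨_, _, _, inferInstance, _, h⟩

end Existence

theorem exists_isSpecial : ∃ lam : ℕ → ℝ≥0, IsSpecial lam := by
  -- Integer division recovers `n` from both `2n` and `2n+1`. The unconstrained values at `0` and
  -- `1` come out as `0`, which is harmless.
  refine ⟨fun m => if Even m then ((m / 2 : ℕ) : ℝ≥0) ^ (-(3 / 4) : ℝ)
    else ((m / 2 : ℕ) : ℝ≥0) ^ (-(5 / 16) : ℝ), fun n _ => ?_, fun n _ => ?_⟩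
  · simp
  · have h : (2 * n + 1) / 2 = n := by omega
    simp [h]

theorem exists_tendsto_zero_not_tendsto_chaosProj :
    ∃ (Ω : Type) (_ : MeasurableSpace Ω) (P : Measure Ω) (_ : IsProbabilityMeasure P)
      (N : Ω → Measure ℝ≥0), IsPoissonProcess N halfLine P ∧
      ∃ F : ℕ → Lp ℝ 2 P,
        (∀ n, F n ∈ chaosUpTo N halfLine P 2) ∧
        (∀ᵐ ω ∂P, Tendsto (fun n => F n ω) atTop (𝓝 0)) ∧
        Tendsto F atTop (𝓝 0) ∧
        ¬ ∀ᵐ ω ∂P, Tendsto (fun n => chaosProj N halfLine P 1 (F n) ω) atTop (𝓝 0) := by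
  obtain ⟨Ω, mΩ, P, hP, N, hN⟩ := exists_isPoissonProcess_halfLine
  obtain ⟨lam, hlam⟩ := exists_isSpecial
  have hY := hN.isIndepPoissonSeq_cellCount lam
  -- The sequence is shifted by one, since the chaos statement is available only for indices `n ≥
  -- 1`.
  choose h hmem hproj using fun n : ℕ => hN.fullSeq_chaos lam (n := n + 1) (by omega)
  refine ⟨Ω, mΩ, P, hP, N, hN, fun n => (h n).toLp, hmem, ?_, ?_, fun hcon => ?_⟩
  · filter_upwards [ae_all_iff.2 fun n => (h n).coeFn_toLp, ae_tendsto_fullSeq hlam hY]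
      with ω h1 h2
    simp_rw [h1]
    exact (tendsto_add_atTop_iff_nat 1).2 h2
  · rw [tendsto_zero_iff_norm_tendsto_zero]
    -- On a probability space the norm in `L_2` is at most the norm in `L_{5/2}`.
    have t1 : Tendsto (fun n => eLpNorm (fullSeq (cellCount N lam) lam (n + 1)) 2 P) atTop
        (𝓝 0) := by
      refine tendsto_of_tendsto_of_tendsto_of_le_of_le tendsto_const_nhds
        ((tendsto_add_atTop_iff_nat 1).2 (tendsto_eLpNorm_fullSeq hlam hY))
        (fun n => zero_le) fun n => eLpNorm_le_eLpNorm_of_exponent_le ?_ (h n).1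
      rw [ENNReal.le_div_iff_mul_le (by simp) (by simp)]
      norm_num
    have t2 := (ENNReal.tendsto_toReal ENNReal.zero_ne_top).comp t1
    simpa [Function.comp_def, Lp.norm_toLp] using t2
  · have hfalse : ∀ᵐ _ ∂P, False := by
      filter_upwards [hcon, ae_all_iff.2 hproj, ae_not_tendsto_firstPart hlam hY] with ω h1 h2 h3
      simp_rw [h2] at h1
      exact h3 ((tendsto_add_atTop_iff_nat 1).1 h1)
    obtain ⟨_, hω⟩ := hfalse.exists
    exact hω

end PoissonChaos

end

theorem mainTheorem2 :
    -- (a) counts of a Poisson process on `[0, ∞)`, for arbitrary positive parameters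
    (∀ (Ω : Type*) [MeasurableSpace Ω] (P : Measure Ω) [IsProbabilityMeasure P]
      (N : Ω → Measure ℝ≥0), PoissonChaos.IsPoissonProcess N PoissonChaos.halfLine P →
      ∀ lam : ℕ → ℝ≥0, (∀ n, 1 ≤ n → 0 < lam n) →
        PoissonChaos.IsIndepPoissonSeq (PoissonChaos.cellCount N lam) lam P ∧
        ∀ n, 1 ≤ n →
          ∃ h : MemLp (PoissonChaos.fullSeq (PoissonChaos.cellCount N lam) lam n) 2 P,
            h.toLp ∈ PoissonChaos.chaosUpTo N PoissonChaos.halfLine P 2 ∧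
            PoissonChaos.chaosProj N PoissonChaos.halfLine P 1 h.toLp =ᵐ[P]
              PoissonChaos.firstPart (PoissonChaos.cellCount N lam) lam n) ∧
    -- (b) the convergence properties, for the special parameters
    (∀ (Ω : Type*) [MeasurableSpace Ω] (P : Measure Ω) [IsProbabilityMeasure P]
      (Y : ℕ → Ω → ℝ) (lam : ℕ → ℝ≥0),
      (∀ n : ℕ, 1 ≤ n → lam (2 * n) = (n : ℝ≥0) ^ (-(3 / 4) : ℝ)) →
      (∀ n : ℕ, 1 ≤ n → lam (2 * n + 1) = (n : ℝ≥0) ^ (-(5 / 16) : ℝ)) →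
      PoissonChaos.IsIndepPoissonSeq Y lam P →
        (∀ᵐ ω ∂P, Tendsto (fun n => PoissonChaos.fullSeq Y lam n ω) atTop (𝓝 0)) ∧
        (∀ n, 1 ≤ n → MemLp (PoissonChaos.fullSeq Y lam n) (5 / 2) P) ∧
        Tendsto (fun n => eLpNorm (PoissonChaos.fullSeq Y lam n) (5 / 2) P) atTop (𝓝 0) ∧
        (∀ δ : ℝ, 0 < δ → δ < 1 / 24 →
          ∫⁻ ω, (⨆ n : ℕ, ⨆ _ : 1 ≤ n, ‖PoissonChaos.fullSeq Y lam n ω‖ₑ) ^ δ ∂P < ∞) ∧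
        (∀ᵐ ω ∂P, ¬ Tendsto (fun n => PoissonChaos.firstPart Y lam n ω) atTop (𝓝 0))) ∧
    -- (c) the negative answer: almost sure and `L²` convergence in `T_2` do not pass to `J_1`
    (∃ (Ω : Type) (_ : MeasurableSpace Ω) (P : Measure Ω) (_ : IsProbabilityMeasure P)
      (N : Ω → Measure ℝ≥0), PoissonChaos.IsPoissonProcess N PoissonChaos.halfLine P ∧
      ∃ F : ℕ → Lp ℝ 2 P,
        (∀ n, F n ∈ PoissonChaos.chaosUpTo N PoissonChaos.halfLine P 2) ∧
        (∀ᵐ ω ∂P, Tendsto (fun n => F n ω) atTop (𝓝 0)) ∧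
        Tendsto F atTop (𝓝 0) ∧
        ¬ ∀ᵐ ω ∂P, Tendsto (fun n => PoissonChaos.chaosProj N PoissonChaos.halfLine P 1 (F n) ω)
          atTop (𝓝 0)) := by
  refine ⟨?_, ?_, PoissonChaos.exists_tendsto_zero_not_tendsto_chaosProj⟩
  · intro Ω _ P _ N hN lam _
    exact ⟨hN.isIndepPoissonSeq_cellCount lam, fun n hn => hN.fullSeq_chaos lam hn⟩
  · intro Ω _ P _ Y lam heven hodd hY
    have hlam : PoissonChaos.IsSpecial lam := ⟨heven, hodd⟩
    exact ⟨PoissonChaos.ae_tendsto_fullSeq hlam hY,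
      fun n hn => PoissonChaos.memLp_fullSeq hlam hY hn,
      PoissonChaos.tendsto_eLpNorm_fullSeq hlam hY,
      fun δ h0 h1 => PoissonChaos.lintegral_iSup_enorm_fullSeq_rpow_lt_top hlam hY h0
        (h1.trans (by norm_num)),
      PoissonChaos.ae_not_tendsto_firstPart hlam hY⟩
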